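/- **Conventions.** Banach spaces are real; $B$, $S$ denote the closed unit ball and unit sphere of $(X,\|\cdot\|)$, and $S^*$ the unit sphere of $X^*$ for the dual norm. A normed space $(Y,\|\cdot\|_Y)$ is *locally uniformly convex* (LUR) if for every $x$ with $\|x\|_Y=1$ and every sequence $(y_n)$ with $\|y_n\|_Y=1$ and $\|\frac{x+y_n}{2}\|_Y\to 1$ one has $\|x-y_n\|_Y\to0$. A *nearest point map* onto a subset $C$ of a metric space $(M,d)$ is a map $R:M\to C$ with $d(x,R(x))=\inf_{c\in C}d(x,c)$ for all $x\in M$. **Blueprint norms.** Let $0<\rho<1/4$ and let $\alpha=(v,v^*,e,e^*,h,h^*,t)$ with $v,e,h\in S$, $v^*,e^*,h^*\in S^*$, $0<t<\rho/16$, $v^*(v)=e^*(e)=h^*(h)=1$ and $|e^*(h)|<\rho/800$. Put $x_\alpha^{\pm}=(1-\frac{\rho}{2})e\pm th$, $y_\alpha^{+}=x_\alpha^++\frac{\rho}{4}v$, $y_\alpha^-=x_\alpha^--\frac{\rho}{4}v$, $S_\alpha=\{x\in B: e^*(x)>1-\rho\}$ and $$B_\alpha=\mathrm{co}\big((B\setminus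 (S_\alpha\cup -S_\alpha))\cup\{y_\alpha^{+},y_\alpha^{-},-y_\alpha^{+},-y_\alpha^{-}\}\big).$$ Let $\|\cdot\|_\alpha$ be the Minkowski functional of $B_\alpha$. **Construction data.** For a Banach space $X$, construction data consist of a partition $(A_i)_{i\in\mathbb N}$ of $\mathbb N$ into infinite sets, together with $v_n,e_n\in S$, $v_n^*,e_n^*\in S^*$ and real numbers $t_n,\eta_n,\varepsilon_i$ such that: 1. $0<t_n<\rho/16$ for all $n$, and for every $t>0$ there is $i$ with $t_n<t$ for all $n\in A_i$; 2. $v_n^*(v_n)=1$ for all $n$, and $\{v_n:n\in A_i\}$ is dense in $S$ for every $i$; 3. $e_n^*(e_n)=1$ for all $n$, and $|e_n^*(e_m)|<\rho/800$ for all $n\neq m$; 4. $(e_n^*)_n$ is weak$^*$-null; 5. $0<\eta_n<\min\{\frac{t_n\rho}{12800},(1-\frac{\rho}{8})^{-1}-1\}$ for all $n$, and $\eta_n=\varepsilon_i$ whenever $n\in A_i$. Put $\alpha_n=(v_n,v_n^*,e_n,e_n^*,e_{n+1},e_{n+1}^*,t_n)$. **Theorem.** Let $(X,\|\cdot\|)$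 be an infinite-dimensional separable LUR Banach space and let $0<\rho<1/4$. Then construction data exist. For any construction data there are LUR norms $\|\cdot\|_n$ on $X$ with $$\|\cdot\|_{\alpha_n}\le\|\cdot\|_n\le(1+\eta_n)\|\cdot\|_{\alpha_n}\qquad(n\in\mathbb N).$$ For any construction data and any such sequence of LUR norms, the supremum $$|||x|||_\rho=\sup_{n\in\mathbb N}\Big\{\|x\|_n,\ \big(1-\tfrac{\rho}{8}\big)^{-1}\|x\|\Big\}$$ is finite for every $x\in X$ and defines a norm on $X$ such that: * $(X,|||\cdot|||_\rho)$ is LUR; * $(1-\frac{\rho}{8})^{-1}\|x\|\le|||x|||_\rho\le(1-\frac{\rho}{8})^{-1}(1-\rho)^{-1}\|x\|$ for all $x\in X$, and there is an isomorphism $T:(X,\|\cdot\|)\to(X,|||\cdot|||_\rho)$ with $\|T\|\,\|T^{-1}\|\le(1-\rho)^{-1}$; * for every compact convex $K\subset X$ with at least two points, there is exactly one nearest point map $R:(X,|||\cdot|||_\rho)\to K$, and it is continuous but not uniformly continuous with respect to $|||\cdot|||_\rho$. -/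

import Mathlib

open Set Filter Topology

/-- A real (semi)normed space is locally uniformly convex (LUR) if, for every unit vector `x` and
every sequence of unit vectors `y n` with `‖(x + y n) / 2‖ → 1`, one has `‖x - y n‖ → 0`. -/
def LocallyUniformlyConvex (E : Type*) [SeminormedAddCommGroup E] [NormedSpace ℝ E] : Prop :=
  ∀ x : E, ‖x‖ = 1 → ∀ y : ℕ → E, (∀ n, ‖y n‖ = 1) →
    Tendsto (fun n => ‖(1 / 2 : ℝ) • (x + y n)‖) atTop (𝓝 1) →
    Tendsto (fun n => ‖x - y n‖) atTop (𝓝 0)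

/-- A map `R : M → C` onto a subset `C` of a metric space is a nearest point map if
`d(x, R x) = inf {d(x, c) : c ∈ C}` for every `x`. -/
def IsNearestPointMap {M : Type*} [PseudoMetricSpace M] (C : Set M) (R : M → C) : Prop :=
  ∀ x : M, dist x (R x : M) = Metric.infDist x C

section Renorming

variable {X : Type*} [AddCommGroup X] [Module ℝ X]

/-- The space `(X, p)`: the vector space `X` equipped with the (semi)norm `p`. -/
def Renormed (_p : Seminorm ℝ X) : Type _ := X

noncomputable instance (p : Seminorm ℝ X) : SeminormedAddCommGroup (Renormed p) :=
  AddGroupSeminorm.toSeminormedAddCommGroup (E := X) p.toAddGroupSeminorm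

instance (p : Seminorm ℝ X) : Module ℝ (Renormed p) :=
  inferInstanceAs (Module ℝ X)

/-- The identity map from `X` to `(X, p)`. -/
def toRenormed (p : Seminorm ℝ X) : X ≃ₗ[ℝ] Renormed p where
  toFun x := x
  invFun x := x
  map_add' _ _ := rfl
  map_smul' _ _ := rfl
  left_inv _ := rfl
  right_inv _ := rfl

theorem norm_toRenormed (p : Seminorm ℝ X) (x : X) : ‖toRenormed p x‖ = p x := rfl

noncomputable instance (p : Seminorm ℝ X) : NormedSpace ℝ (Renormed p) where
  norm_smul_le a x := (map_smul_eq_mul p a ((toRenormed p).symm x)).le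

end Renorming

section Blueprint

/-- The admissible tuples `α = (v, v*, e, e*, h, h*, t)`. -/
structure BlueprintTuple (X : Type*) [NormedAddCommGroup X] [NormedSpace ℝ X] (ρ : ℝ) where
  v : X
  vStar : StrongDual ℝ X
  e : X
  eStar : StrongDual ℝ X
  h : X
  hStar : StrongDual ℝ X
  t : ℝ
  norm_v : ‖v‖ = 1
  norm_vStar : ‖vStar‖ = 1
  norm_e : ‖e‖ = 1
  norm_eStar : ‖eStar‖ = 1
  norm_h : ‖h‖ = 1
  norm_hStar : ‖hStar‖ = 1
  t_pos : 0 < t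
  t_lt : t < ρ / 16
  vStar_v : vStar v = 1
  eStar_e : eStar e = 1
  hStar_h : hStar h = 1
  eStar_h : |eStar h| < ρ / 800

namespace BlueprintTuple

variable {X : Type*} [NormedAddCommGroup X] [NormedSpace ℝ X] {ρ : ℝ}

/-- `x⁺ = (1 - ρ/2) e + t h`. -/
noncomputable def xPlus (α : BlueprintTuple X ρ) : X := (1 - ρ / 2) • α.e + α.t • α.h

/-- `x⁻ = (1 - ρ/2) e - t h`. -/
noncomputable def xMinus (α : BlueprintTuple X ρ) : X := (1 - ρ / 2) • α.e - α.t • α.h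

/-- `y⁺ = x⁺ + (ρ/4) v`. -/
noncomputable def yPlus (α : BlueprintTuple X ρ) : X := α.xPlus + (ρ / 4) • α.v

/-- `y⁻ = x⁻ - (ρ/4) v`. -/
noncomputable def yMinus (α : BlueprintTuple X ρ) : X := α.xMinus - (ρ / 4) • α.v

/-- The slice `S_α` of the unit ball. -/
def slice (α : BlueprintTuple X ρ) : Set X :=
  {x | x ∈ Metric.closedBall (0 : X) 1 ∧ 1 - ρ < α.eStar x}

/-- The set `B_α = co ((B \ ±S_α) ∪ {y⁺, y⁻, -y⁺, -y⁻})`. -/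
noncomputable def ball (α : BlueprintTuple X ρ) : Set X :=
  convexHull ℝ
    ((Metric.closedBall (0 : X) 1 \ (α.slice ∪ {x | -x ∈ α.slice})) ∪
      {α.yPlus, α.yMinus, -α.yPlus, -α.yMinus})

/-- The blueprint norm `‖·‖_α`: the Minkowski functional of `B_α`. -/
noncomputable def blueprintNorm (α : BlueprintTuple X ρ) (x : X) : ℝ := gauge α.ball x

end BlueprintTuple

/-- The parameters of the construction: a partition of `ℕ` into infinitely many infinite sets
`A i`, and sequences `v, v*, e, e*, t, η` subject to the conditions below. -/
structure ConstructionData (X : Type*) [NormedAddCommGroup X] [NormedSpace ℝ X] (ρ : ℝ) where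
  A : ℕ → Set ℕ
  A_infinite : ∀ i, (A i).Infinite
  A_disjoint : Pairwise (fun i j => Disjoint (A i) (A j))
  A_cover : ⋃ i, A i = univ
  v : ℕ → X
  vStar : ℕ → StrongDual ℝ X
  e : ℕ → X
  eStar : ℕ → StrongDual ℝ X
  t : ℕ → ℝ
  η : ℕ → ℝ
  ε : ℕ → ℝ
  t_pos : ∀ n, 0 < t n
  t_lt : ∀ n, t n < ρ / 16
  t_small : ∀ s : ℝ, 0 < s → ∃ i, ∀ n ∈ A i, t n < s
  norm_v : ∀ n, ‖v n‖ = 1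
  norm_vStar : ∀ n, ‖vStar n‖ = 1
  vStar_v : ∀ n, vStar n (v n) = 1
  v_dense : ∀ i, Metric.sphere (0 : X) 1 ⊆ closure (v '' A i)
  norm_e : ∀ n, ‖e n‖ = 1
  norm_eStar : ∀ n, ‖eStar n‖ = 1
  eStar_e : ∀ n, eStar n (e n) = 1
  almost_biorthogonal : ∀ n m, n ≠ m → |eStar n (e m)| < ρ / 800
  /-- `e*` converges to `0` in the weak* topology -/
  weakStar_null : ∀ x : X, Tendsto (fun n => eStar n x) atTop (𝓝 0)
  η_pos : ∀ n, 0 < η n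
  η_lt : ∀ n, η n < min (t n * ρ / 12800) ((1 - ρ / 8)⁻¹ - 1)
  η_eq : ∀ i, ∀ n ∈ A i, η n = ε i

namespace ConstructionData

variable {X : Type*} [NormedAddCommGroup X] [NormedSpace ℝ X] {ρ : ℝ}

/-- The tuple `α_n = (v_n, v_n*, e_n, e_n*, e_{n+1}, e_{n+1}*, t_n)`. -/
def tuple (D : ConstructionData X ρ) (n : ℕ) : BlueprintTuple X ρ where
  v := D.v n
  vStar := D.vStar n
  e := D.e n
  eStar := D.eStar n
  h := D.e (n + 1)
  hStar := D.eStar (n + 1)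
  t := D.t n
  norm_v := D.norm_v n
  norm_vStar := D.norm_vStar n
  norm_e := D.norm_e n
  norm_eStar := D.norm_eStar n
  norm_h := D.norm_e (n + 1)
  norm_hStar := D.norm_eStar (n + 1)
  t_pos := D.t_pos n
  t_lt := D.t_lt n
  vStar_v := D.vStar_v n
  eStar_e := D.eStar_e n
  hStar_h := D.eStar_e (n + 1)
  eStar_h := D.almost_biorthogonal n (n + 1) (Nat.succ_ne_self n).symm

/-- `N n` is a sequence of LUR norms with `‖·‖_{α_n} ≤ N n ≤ (1 + η_n) ‖·‖_{α_n}`. -/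
def IsLURApproximation (D : ConstructionData X ρ) (N : ℕ → Seminorm ℝ X) : Prop :=
  ∀ n, LocallyUniformlyConvex (Renormed (N n)) ∧
    ∀ x, (D.tuple n).blueprintNorm x ≤ N n x ∧
      N n x ≤ (1 + D.η n) * (D.tuple n).blueprintNorm x

end ConstructionData

/-- `p` is the norm `x ↦ sup_n {N n x, (1 - ρ/8)⁻¹ ‖x‖}` (the supremum being finite). -/
def IsFinalNorm {X : Type*} [NormedAddCommGroup X] [NormedSpace ℝ X] (ρ : ℝ)
    (N : ℕ → Seminorm ℝ X) (p : Seminorm ℝ X) : Prop :=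
  ∀ x, IsLUB (insert ((1 - ρ / 8)⁻¹ * ‖x‖) (range fun n => N n x)) (p x)

end Blueprint

/-! ### Local uniform convexity in quadratic form. -/

section LUR

variable {E : Type*} [SeminormedAddCommGroup E] [NormedSpace ℝ E]

/-! Each $\|\cdot\|_{\alpha_n}$ alters the norm only locally: its gauge does not exceed $\|\cdot\|$
outside the cone $|e_n^*(x)|>(1-\rho)\|x\|$. Since $(e_n^*)$ is weak* null, a fixed $x$ leaves all
but finitely many of these cones. For the other $n$, the factor $(1-\rho/8)^{-1}$ keeps $N_n(x)$
uniformly below the final norm $p(x)$. Hence a midpoint that is almost extremal for $p$ is almost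
extremal for one of finitely many LUR norms, and $p$ is LUR (`IsFinalNorm.locallyUniformlyConvex`).
Existence, uniqueness and continuity of the nearest point map onto a compact convex set follow.

Uniform continuity fails because of the corners $y^\pm$. Scale a segment of $K$ to $[-\frac\rho4
v,\frac\rho4 v]$ and choose $n$ in a block with small $t_n$, so large that $e_n^*,e_{n+1}^*$ are
nearly zero on the scaled $K$, and with $v_n$ close to $v$. The centres $x^\pm$ are $2t_n$ apart.
Subtracting $\mp\frac\rho4 v$ from $x^\pm$ nearly gives $y^\pm$, of $p$-norm at most $1+\eta_n$. A
combination of $e_n^*$ and $e_{n+1}^*$ strongly exposes $y^+$ in the blueprint ball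
(`BlueprintTuple.norm_sub_yPlus_le`), while both functionals hardly vary over $K$. So every nearest
point to $x^+$ lies near $-\frac\rho4 v$, and, by symmetry, every nearest point to $x^-$ lies near
$+\frac\rho4 v$.

The delicate part of the existence of data is almost biorthogonality in both directions. It needs a
unit vector in the kernel of the earlier functionals whose distance to a given finite-dimensional
space is almost 1 (`exists_almost_orthogonal`). This comes from a spreading-model argument with
iterated ultralimits. A variational perturbation (`exists_norming_pair`) then supplies a norming
functional that is small on that space. -/

theorem LocallyUniformlyConvex.exists_pos_forall_norm_sub_lt (hE : LocallyUniformlyConvex E)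
    (x : E) {ε : ℝ} (hε : 0 < ε) :
    ∃ δ > 0, ∀ y : E, 2 * ‖x‖ ^ 2 + 2 * ‖y‖ ^ 2 - ‖x + y‖ ^ 2 < δ → ‖x - y‖ < ε := by
  by_cases hx : ‖x‖ = 0
  · refine ⟨ε ^ 2, by positivity, fun y hy => ?_⟩
    have h1 : ‖x + y‖ ≤ ‖y‖ := by simpa [hx] using norm_add_le x y
    have h2 : ‖x - y‖ ≤ ‖y‖ := by simpa [hx] using norm_sub_le x y
    have h3 : ‖x + y‖ ^ 2 ≤ ‖y‖ ^ 2 := by gcongr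
    rw [hx] at hy
    have h4 : ‖y‖ < ε := lt_of_pow_lt_pow_left₀ 2 hε.le (by linarith)
    linarith
  have hx0 : 0 < ‖x‖ := lt_of_le_of_ne (norm_nonneg _) (Ne.symm hx)
  by_contra! hcon
  have hpos : ∀ k : ℕ, (0 : ℝ) < 1 / ((k : ℝ) + 1) := fun k => by positivity
  choose y hlt hge using fun k : ℕ => hcon _ (hpos k)
  have hlim := tendsto_one_div_add_atTop_nhds_zero_nat (𝕜 := ℝ)
  -- $2a^2+2b^2-(a+b)^2=(a-b)^2$, so a small deficit forces the norms together.
  have hsq : ∀ k, (‖y k‖ - ‖x‖) ^ 2 ≤ 1 / ((k : ℝ) + 1) := fun k => by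
    have h1 : ‖x + y k‖ ^ 2 ≤ (‖x‖ + ‖y k‖) ^ 2 := by gcongr; exact norm_add_le _ _
    nlinarith [hlt k]
  have hy : Tendsto (fun k => ‖y k‖) atTop (𝓝 ‖x‖) := by
    have h1 : Tendsto (fun k => (‖y k‖ - ‖x‖) ^ 2) atTop (𝓝 0) :=
      squeeze_zero (fun k => sq_nonneg _) hsq hlim
    have h2 := h1.sqrt
    simp only [Real.sqrt_sq_eq_abs, Real.sqrt_zero] at h2
    have h3 := (tendsto_zero_iff_abs_tendsto_zero _).2 h2
    simpa using h3.add_const ‖x‖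
  have hxy : Tendsto (fun k => ‖x + y k‖) atTop (𝓝 (2 * ‖x‖)) := by
    have h1 : Tendsto (fun k => 2 * ‖x‖ ^ 2 + 2 * ‖y k‖ ^ 2 - 1 / ((k : ℝ) + 1)) atTop
        (𝓝 ((2 * ‖x‖) ^ 2)) := by
      have := ((hy.pow 2).const_mul 2).const_add (2 * ‖x‖ ^ 2) |>.sub hlim
      convert this using 2; ring
    have h2 : Tendsto (fun k => (‖x‖ + ‖y k‖) ^ 2) atTop (𝓝 ((2 * ‖x‖) ^ 2)) := by
      have := (hy.const_add ‖x‖).pow 2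
      convert this using 2; ring
    have h3 : Tendsto (fun k => ‖x + y k‖ ^ 2) atTop (𝓝 ((2 * ‖x‖) ^ 2)) :=
      tendsto_of_tendsto_of_tendsto_of_le_of_le h1 h2 (fun k => by
        have := hlt k; simp only; linarith)
        (fun k => by simp only; gcongr; exact norm_add_le _ _)
    have h4 := h3.sqrt
    simpa [Real.sqrt_sq, hx0.le] using h4
  set u : E := ‖x‖⁻¹ • x with hu
  have hu1 : ‖u‖ = 1 := by rw [hu, norm_smul, norm_inv, norm_norm, inv_mul_cancel₀ hx]
  -- The value `u` only keeps every term on the unit sphere; since `‖y k‖ → ‖x‖ > 0`, it is used for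
  -- finitely many `k`.
  let z : ℕ → E := fun k => if ‖y k‖ = 0 then u else ‖y k‖⁻¹ • y k
  have hz1 : ∀ k, ‖z k‖ = 1 := fun k => by
    by_cases h : ‖y k‖ = 0
    · simp only [z, h, if_true, hu1]
    · simp only [z, h, if_false, norm_smul, norm_inv, norm_norm]
      exact inv_mul_cancel₀ h
  have hzy : Tendsto (fun k => ‖z k - ‖x‖⁻¹ • y k‖) atTop (𝓝 0) := by
    have h1 : Tendsto (fun k => |‖y k‖⁻¹ - ‖x‖⁻¹| * ‖y k‖) atTop (𝓝 0) := by
      have := (((hy.inv₀ hx).sub_const ‖x‖⁻¹).abs).mul hy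
      simpa using this
    refine h1.congr' ?_
    filter_upwards [hy.eventually (lt_mem_nhds hx0)] with k hk
    simp only [z, hk.ne', if_false]
    rw [← sub_smul, norm_smul, Real.norm_eq_abs]
  have hmid : Tendsto (fun k => ‖(1 / 2 : ℝ) • (u + z k)‖) atTop (𝓝 1) := by
    have h1 : Tendsto (fun k => (1 / 2 : ℝ) * (‖x‖⁻¹ * ‖x + y k‖)) atTop (𝓝 1) := by
      have := (hxy.const_mul ‖x‖⁻¹).const_mul (1 / 2 : ℝ)
      convert this using 2
      field_simp
    refine h1.congr_dist (squeeze_zero (fun _ => dist_nonneg) (fun k => ?_) hzy)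
    have h2 : (1 / 2 : ℝ) * (‖x‖⁻¹ * ‖x + y k‖) = ‖(1 / 2 : ℝ) • (u + ‖x‖⁻¹ • y k)‖ := by
      rw [hu, ← smul_add, norm_smul, norm_smul, norm_inv, norm_norm]; norm_num
    rw [h2, Real.dist_eq]
    refine (abs_norm_sub_norm_le _ _).trans ?_
    rw [← smul_sub, norm_smul, norm_sub_rev, add_sub_add_left_eq_sub]
    have : ‖(1 / 2 : ℝ)‖ ≤ 1 := by norm_num
    nlinarith [norm_nonneg (z k - ‖x‖⁻¹ • y k)]
  have huz := hE u hu1 z hz1 hmid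
  have hfin : Tendsto (fun k => ‖x‖ * (‖u - z k‖ + ‖z k - ‖x‖⁻¹ • y k‖)) atTop (𝓝 0) := by
    simpa using (huz.add hzy).const_mul ‖x‖
  obtain ⟨k, hk⟩ := (hfin.eventually (gt_mem_nhds hε)).exists
  have h1 : ‖x - y k‖ ≤ ‖x‖ * (‖u - z k‖ + ‖z k - ‖x‖⁻¹ • y k‖) := by
    have h2 : x - y k = ‖x‖ • ((u - z k) + (z k - ‖x‖⁻¹ • y k)) := by
      rw [sub_add_sub_cancel, hu, ← smul_sub, smul_inv_smul₀ hx]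
    rw [h2, norm_smul, norm_norm]
    gcongr
    exact norm_add_le _ _
  linarith [hge k]

theorem locallyUniformlyConvex_of_forall_exists_pos
    (h : ∀ x : E, ‖x‖ = 1 → ∀ ε > 0, ∃ δ > 0, ∀ y : E, ‖y‖ = 1 →
      1 - δ < ‖(1 / 2 : ℝ) • (x + y)‖ → ‖x - y‖ < ε) :
    LocallyUniformlyConvex E := by
  intro x hx y hy hlim
  rw [Metric.tendsto_atTop']
  intro ε hε
  obtain ⟨δ, hδ, H⟩ := h x hx ε hε
  have h1 : ∀ᶠ n in atTop, 1 - δ < ‖(1 / 2 : ℝ) • (x + y n)‖ :=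
    hlim.eventually (lt_mem_nhds (by linarith))
  obtain ⟨N, hN⟩ := eventually_atTop.1 h1
  refine ⟨N, fun n hn => ?_⟩
  simpa using H _ (hy n) (hN n hn.le)

end LUR

/-! ### Blueprint balls and their LUR approximations. -/

section BlueprintNorm

variable {X : Type*} [NormedAddCommGroup X] [NormedSpace ℝ X] {ρ : ℝ}

namespace BlueprintTuple

theorem norm_yPlus_le (α : BlueprintTuple X ρ) (hρ0 : 0 < ρ) (hρ1 : ρ < 1 / 4) :
    ‖α.yPlus‖ ≤ 1 - 3 * ρ / 16 := by
  have h1 : ‖(1 - ρ / 2) • α.e‖ = 1 - ρ / 2 := by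
    rw [norm_smul, α.norm_e, mul_one, Real.norm_of_nonneg (by linarith)]
  have h2 : ‖α.t • α.h‖ = α.t := by
    rw [norm_smul, α.norm_h, mul_one, Real.norm_of_nonneg α.t_pos.le]
  have h3 : ‖(ρ / 4) • α.v‖ = ρ / 4 := by
    rw [norm_smul, α.norm_v, mul_one, Real.norm_of_nonneg (by linarith)]
  have := norm_add₃_le (a := (1 - ρ / 2) • α.e) (b := α.t • α.h) (c := (ρ / 4) • α.v)
  unfold yPlus xPlus
  linarith [α.t_lt]

/-- The tuple obtained by replacing `v`, `v*`, `h`, `h*` by their negatives. -/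
def flip (α : BlueprintTuple X ρ) : BlueprintTuple X ρ where
  v := -α.v
  vStar := -α.vStar
  e := α.e
  eStar := α.eStar
  h := -α.h
  hStar := -α.hStar
  t := α.t
  norm_v := by rw [norm_neg, α.norm_v]
  norm_vStar := by rw [norm_neg, α.norm_vStar]
  norm_e := α.norm_e
  norm_eStar := α.norm_eStar
  norm_h := by rw [norm_neg, α.norm_h]
  norm_hStar := by rw [norm_neg, α.norm_hStar]
  t_pos := α.t_pos
  t_lt := α.t_lt
  vStar_v := by simp [α.vStar_v]
  eStar_e := α.eStar_e
  hStar_h := by simp [α.hStar_h]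
  eStar_h := by simpa using α.eStar_h

theorem flip_xPlus (α : BlueprintTuple X ρ) : α.flip.xPlus = α.xMinus := by
  simp only [flip, xPlus, xMinus]; module

theorem flip_yPlus (α : BlueprintTuple X ρ) : α.flip.yPlus = α.yMinus := by
  simp only [flip, yPlus, yMinus, xPlus, xMinus]; module

theorem flip_yMinus (α : BlueprintTuple X ρ) : α.flip.yMinus = α.yPlus := by
  simp only [flip, yPlus, yMinus, xPlus, xMinus]; module

theorem flip_ball (α : BlueprintTuple X ρ) : α.flip.ball = α.ball := by
  have h : α.flip.slice = α.slice := rfl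
  unfold ball
  rw [flip_yPlus, flip_yMinus, h]
  congr 2
  ext x
  simp only [mem_insert_iff, mem_singleton_iff]
  tauto

theorem norm_yMinus_le (α : BlueprintTuple X ρ) (hρ0 : 0 < ρ) (hρ1 : ρ < 1 / 4) :
    ‖α.yMinus‖ ≤ 1 - 3 * ρ / 16 := by
  rw [← flip_yPlus]
  exact α.flip.norm_yPlus_le hρ0 hρ1

theorem eStar_le_norm (α : BlueprintTuple X ρ) (x : X) : |α.eStar x| ≤ ‖x‖ := by
  simpa [α.norm_eStar] using α.eStar.le_opNorm x

theorem hStar_le_norm (α : BlueprintTuple X ρ) (x : X) : |α.hStar x| ≤ ‖x‖ := by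
  simpa [α.norm_hStar] using α.hStar.le_opNorm x

theorem mem_diff_slice_iff (α : BlueprintTuple X ρ) {x : X} :
    x ∈ Metric.closedBall (0 : X) 1 \ (α.slice ∪ {x | -x ∈ α.slice}) ↔
      ‖x‖ ≤ 1 ∧ |α.eStar x| ≤ 1 - ρ := by
  simp only [slice, Set.mem_sdiff, Metric.mem_closedBall, dist_zero_right, mem_union, mem_ofPred_eq,
    norm_neg, map_neg, abs_le]
  constructor
  · rintro ⟨h1, h2⟩
    push Not at h2
    exact ⟨h1, by linarith [h2.2 h1], h2.1 h1⟩
  · rintro ⟨h1, h2, h3⟩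
    refine ⟨h1, ?_⟩
    push Not
    exact ⟨fun _ => h3, fun _ => by linarith⟩

theorem convex_ball (α : BlueprintTuple X ρ) : Convex ℝ α.ball := convex_convexHull ℝ _

theorem mem_ball_of_abs_eStar_le (α : BlueprintTuple X ρ) {x : X} (h1 : ‖x‖ ≤ 1)
    (h2 : |α.eStar x| ≤ 1 - ρ) : x ∈ α.ball :=
  subset_convexHull ℝ _ (Or.inl (α.mem_diff_slice_iff.2 ⟨h1, h2⟩))

theorem yPlus_mem_ball (α : BlueprintTuple X ρ) : α.yPlus ∈ α.ball :=
  subset_convexHull ℝ _ (Or.inr (by simp))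

theorem yMinus_mem_ball (α : BlueprintTuple X ρ) : α.yMinus ∈ α.ball :=
  subset_convexHull ℝ _ (Or.inr (by simp))

theorem ball_subset_closedBall (α : BlueprintTuple X ρ) (hρ0 : 0 < ρ) (hρ1 : ρ < 1 / 4) :
    α.ball ⊆ Metric.closedBall 0 1 := by
  refine convexHull_min ?_ (convex_closedBall _ _)
  refine union_subset sdiff_subset ?_
  have h1 := α.norm_yPlus_le hρ0 hρ1
  have h2 := α.norm_yMinus_le hρ0 hρ1
  rintro x (rfl | rfl | rfl | rfl) <;> simp only [mem_closedBall_zero_iff, norm_neg] <;> linarith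

theorem closedBall_subset_ball (α : BlueprintTuple X ρ) (hρ0 : 0 < ρ) :
    Metric.closedBall 0 (1 - ρ) ⊆ α.ball := fun x hx => by
  rw [mem_closedBall_zero_iff] at hx
  exact α.mem_ball_of_abs_eStar_le (by linarith) ((α.eStar_le_norm x).trans hx)

theorem zero_mem_ball (α : BlueprintTuple X ρ) (hρ1 : ρ < 1 / 4) :
    (0 : X) ∈ α.ball :=
  α.mem_ball_of_abs_eStar_le (by simp) (by simp; linarith)

theorem ball_mem_nhds (α : BlueprintTuple X ρ) (hρ0 : 0 < ρ) (hρ1 : ρ < 1 / 4) :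
    α.ball ∈ 𝓝 (0 : X) :=
  Filter.mem_of_superset (Metric.closedBall_mem_nhds _ (by linarith)) (α.closedBall_subset_ball hρ0)

theorem absorbent_ball (α : BlueprintTuple X ρ) (hρ0 : 0 < ρ) (hρ1 : ρ < 1 / 4) :
    Absorbent ℝ α.ball :=
  absorbent_nhds_zero (α.ball_mem_nhds hρ0 hρ1)

theorem balanced_ball (α : BlueprintTuple X ρ) : Balanced ℝ α.ball := by
  rw [balanced_iff_neg_mem α.convex_ball]
  intro x hx
  have h : -x ∈ -α.ball := by simpa using hx
  rw [ball, ← convexHull_neg] at h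
  refine convexHull_mono ?_ h
  intro y hy
  rw [Set.mem_neg] at hy
  rcases hy with hy | hy
  · left
    rw [mem_diff_slice_iff] at hy ⊢
    simpa using hy
  · right
    simp only [mem_insert_iff, mem_singleton_iff, neg_inj] at hy ⊢
    rw [neg_eq_iff_eq_neg, neg_eq_iff_eq_neg] at hy
    tauto

theorem norm_le_blueprintNorm (α : BlueprintTuple X ρ) (hρ0 : 0 < ρ) (hρ1 : ρ < 1 / 4) (x : X) :
    ‖x‖ ≤ α.blueprintNorm x := by
  simpa [blueprintNorm] using le_gauge_of_subset_closedBall (α.absorbent_ball hρ0 hρ1) zero_le_one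
    (α.ball_subset_closedBall hρ0 hρ1) (x := x)

theorem blueprintNorm_le_one (α : BlueprintTuple X ρ) {x : X} (hx : x ∈ α.ball) :
    α.blueprintNorm x ≤ 1 := gauge_le_one_of_mem hx

theorem blueprintNorm_le (α : BlueprintTuple X ρ) (hρ0 : 0 < ρ) (hρ1 : ρ < 1 / 4) (x : X) :
    α.blueprintNorm x ≤ (1 - ρ)⁻¹ * ‖x‖ := by
  have h := mul_gauge_le_norm (Metric.ball_subset_closedBall.trans (α.closedBall_subset_ball hρ0))
    (x := x)
  rw [← div_eq_inv_mul, le_div_iff₀' (by linarith)]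
  exact h

/-- The blueprint norm as a seminorm. -/
noncomputable def blueprintSeminorm (α : BlueprintTuple X ρ) (hρ0 : 0 < ρ) (hρ1 : ρ < 1 / 4) :
    Seminorm ℝ X :=
  gaugeSeminorm α.balanced_ball α.convex_ball (α.absorbent_ball hρ0 hρ1)

/-- The normalised vector is itself a generator of the ball. This is the locality of the
modification: the gauge can exceed the norm only in the cone over the two slices. -/
theorem blueprintNorm_le_norm (α : BlueprintTuple X ρ) {x : X}
    (hx : |α.eStar x| ≤ (1 - ρ) * ‖x‖) : α.blueprintNorm x ≤ ‖x‖ := by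
  rcases eq_or_ne x 0 with rfl | h
  · simp [blueprintNorm]
  have h0 : 0 < ‖x‖ := norm_pos_iff.2 h
  refine gauge_le_of_mem h0.le ?_
  rw [mem_smul_set_iff_inv_smul_mem₀ h0.ne']
  refine α.mem_ball_of_abs_eStar_le ?_ ?_
  · rw [norm_smul, norm_inv, norm_norm, inv_mul_cancel₀ h0.ne']
  · rw [map_smul, smul_eq_mul, abs_mul, abs_inv, abs_norm, inv_mul_le_iff₀ h0]
    linarith

theorem exists_smul_mem_ball (α : BlueprintTuple X ρ) (hρ0 : 0 < ρ) (hρ1 : ρ < 1 / 4) {x : X}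
    {r : ℝ} (hx : α.blueprintNorm x < r) : ∃ z ∈ α.ball, x = r • z := by
  have hr : 0 < r := (gauge_nonneg x).trans_lt hx
  refine ⟨r⁻¹ • x, ?_, (smul_inv_smul₀ hr.ne' x).symm⟩
  refine setOfPred_gauge_lt_one_subset_self α.convex_ball (α.zero_mem_ball hρ1)
    (α.absorbent_ball hρ0 hρ1) ?_
  rw [mem_ofPred_eq, gauge_smul_of_nonneg (inv_nonneg.2 hr.le), smul_eq_mul, inv_mul_lt_iff₀ hr]
  simpa [blueprintNorm] using hx

end BlueprintTuple

/-- The seminorm `x ↦ √(q(x)² + η ‖x‖²)`. -/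
noncomputable def Seminorm.sqrtAddSq (q : Seminorm ℝ X) (η : ℝ) (hη : 0 ≤ η) : Seminorm ℝ X :=
  Seminorm.of (fun x => √(q x ^ 2 + η * ‖x‖ ^ 2))
    (fun x y => by
      rw [Real.sqrt_le_left (by positivity)]
      have ha := apply_nonneg q x
      have hb := apply_nonneg q y
      have h1 : q (x + y) ^ 2 ≤ (q x + q y) ^ 2 := by
        have := apply_nonneg q (x + y)
        gcongr; exact map_add_le_add q x y
      have h2 : ‖x + y‖ ^ 2 ≤ (‖x‖ + ‖y‖) ^ 2 := by gcongr; exact norm_add_le x y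
      have hA := Real.sq_sqrt (show 0 ≤ q x ^ 2 + η * ‖x‖ ^ 2 by positivity)
      have hB := Real.sq_sqrt (show 0 ≤ q y ^ 2 + η * ‖y‖ ^ 2 by positivity)
      -- Cauchy–Schwarz in the plane for the vectors $(q,\sqrt\eta\,\|\cdot\|)$ at `x` and `y`.
      have hAB : q x * q y + η * (‖x‖ * ‖y‖) ≤
          √(q x ^ 2 + η * ‖x‖ ^ 2) * √(q y ^ 2 + η * ‖y‖ ^ 2) := by
        rw [← Real.sqrt_mul (by positivity)]
        apply Real.le_sqrt_of_sq_le
        nlinarith [mul_nonneg hη (sq_nonneg (q x * ‖y‖ - q y * ‖x‖))]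
      nlinarith [mul_le_mul_of_nonneg_left h2 hη])
    (fun a x => by
      rw [map_smul_eq_mul, norm_smul,
        show (‖a‖ * q x) ^ 2 + η * (‖a‖ * ‖x‖) ^ 2 = ‖a‖ ^ 2 * (q x ^ 2 + η * ‖x‖ ^ 2) by ring,
        Real.sqrt_mul (sq_nonneg _), Real.sqrt_sq (norm_nonneg a)])

theorem Seminorm.sqrtAddSq_sq (q : Seminorm ℝ X) (η : ℝ) (hη : 0 ≤ η) (x : X) :
    q.sqrtAddSq η hη x ^ 2 = q x ^ 2 + η * ‖x‖ ^ 2 :=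
  Real.sq_sqrt (by positivity)

theorem Seminorm.sq_add_sq_sub_sq_nonneg (q : Seminorm ℝ X) (x y : X) :
    0 ≤ 2 * q x ^ 2 + 2 * q y ^ 2 - q (x + y) ^ 2 := by
  have h1 : q (x + y) ^ 2 ≤ (q x + q y) ^ 2 := by
    have := apply_nonneg q (x + y)
    gcongr; exact map_add_le_add q x y
  nlinarith [sq_nonneg (q x - q y)]

/-- The quadratic deficit of the new norm is that of `q`, which is nonnegative, plus `η` times that
of the LUR norm. So a small total makes the LUR part small. -/
theorem locallyUniformlyConvex_sqrtAddSq (hX : LocallyUniformlyConvex X) (q : Seminorm ℝ X)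
    {η C : ℝ} (hη : 0 < η) (hC : 0 < C) (hqC : ∀ x, q.sqrtAddSq η hη.le x ≤ C * ‖x‖) :
    LocallyUniformlyConvex (Renormed (q.sqrtAddSq η hη.le)) := by
  set N := q.sqrtAddSq η hη.le with hN
  refine locallyUniformlyConvex_of_forall_exists_pos fun (x : X) (hx : N x = 1) ε hε => ?_
  obtain ⟨δ, hδ, H⟩ := hX.exists_pos_forall_norm_sub_lt x (show 0 < ε / C by positivity)
  -- For unit vectors with midpoint norm above $1-s$ the deficit is below $4-4(1-s)^2\le 8s$. The
  -- cap `1` keeps $1-s$ nonnegative for squaring.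
  refine ⟨min (η * δ / 8) 1, by positivity, fun (y : X) (hy : N y = 1) hxy => ?_⟩
  change _ < N ((1 / 2 : ℝ) • (x + y)) at hxy
  change N (x - y) < ε
  rw [map_smul_eq_mul, show ‖(1 / 2 : ℝ)‖ = 1 / 2 by norm_num] at hxy
  have h1 := min_le_left (η * δ / 8) 1
  have h2 := min_le_right (η * δ / 8) 1
  have h3 : (1 - min (η * δ / 8) 1) ^ 2 < (1 / 2 * N (x + y)) ^ 2 := by
    gcongr
  have hx2 := q.sqrtAddSq_sq η hη.le x
  have hy2 := q.sqrtAddSq_sq η hη.le y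
  have hxy2 := q.sqrtAddSq_sq η hη.le (x + y)
  rw [← hN] at hx2 hy2 hxy2
  rw [hx] at hx2
  rw [hy] at hy2
  have h4 := q.sq_add_sq_sub_sq_nonneg x y
  have h5 : ‖x - y‖ < ε / C := by
    apply H
    refine lt_of_mul_lt_mul_left (a := η) ?_ hη.le
    nlinarith [sq_nonneg (min (η * δ / 8) 1)]
  rw [lt_div_iff₀' hC] at h5
  exact (hqC _).trans_lt h5

/-- Take $\sqrt{\|\cdot\|_{\alpha_n}^2+\eta_n\|\cdot\|^2}$. As $\|x\|\le\|x\|_{\alpha_n}$, it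
exceeds the blueprint norm by a factor of at most $\sqrt{1+\eta_n}\le 1+\eta_n$. -/
theorem ConstructionData.exists_isLURApproximation (D : ConstructionData X ρ) (hρ0 : 0 < ρ)
    (hρ1 : ρ < 1 / 4) (hX : LocallyUniformlyConvex X) :
    ∃ N : ℕ → Seminorm ℝ X, D.IsLURApproximation N := by
  have hη := D.η_pos
  let q : ℕ → Seminorm ℝ X := fun n => (D.tuple n).blueprintSeminorm hρ0 hρ1
  have key : ∀ n x, q n x ≤ (q n).sqrtAddSq (D.η n) (hη n).le x ∧
      (q n).sqrtAddSq (D.η n) (hη n).le x ≤ (1 + D.η n) * q n x := fun n x => by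
    have h0 := apply_nonneg (q n) x
    have h1 : ‖x‖ ≤ q n x := (D.tuple n).norm_le_blueprintNorm hρ0 hρ1 x
    have h2 := (q n).sqrtAddSq_sq (D.η n) (hη n).le x
    have h3 := apply_nonneg ((q n).sqrtAddSq (D.η n) (hη n).le) x
    have h4 : ‖x‖ ^ 2 ≤ q n x ^ 2 := by gcongr
    have h5 := hη n
    constructor
    · refine (sq_le_sq₀ h0 h3).1 ?_
      rw [h2]; nlinarith [mul_nonneg h5.le (sq_nonneg ‖x‖)]
    · refine (sq_le_sq₀ h3 (by positivity)).1 ?_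
      rw [h2]
      nlinarith [mul_le_mul_of_nonneg_left h4 h5.le, mul_nonneg h5.le (sq_nonneg (q n x)),
        mul_nonneg (sq_nonneg (D.η n)) (sq_nonneg (q n x))]
  refine ⟨fun n => (q n).sqrtAddSq (D.η n) (hη n).le, fun n => ⟨?_, key n⟩⟩
  have h1 : 0 < (1 - ρ)⁻¹ := inv_pos.2 (by linarith)
  refine locallyUniformlyConvex_sqrtAddSq hX (q n) (hη n)
    (C := (1 + D.η n) * (1 - ρ)⁻¹) (by have := hη n; positivity) fun x => ?_
  refine (key n x).2.trans ?_
  rw [mul_assoc]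
  have := hη n
  gcongr
  exact (D.tuple n).blueprintNorm_le hρ0 hρ1 x

end BlueprintNorm

/-! ### The supremum norm: equivalence and local uniform convexity. -/

section FinalNorm

variable {X : Type*} [NormedAddCommGroup X] [NormedSpace ℝ X] {ρ : ℝ}

namespace ConstructionData

theorem η_lt_mul (D : ConstructionData X ρ) (n : ℕ) : D.η n < D.t n * ρ / 12800 :=
  (D.η_lt n).trans_le (min_le_left _ _)

theorem one_add_η_le (D : ConstructionData X ρ) (n : ℕ) : 1 + D.η n ≤ (1 - ρ / 8)⁻¹ := by
  linarith [(D.η_lt n).trans_le (min_le_right _ _)]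

theorem η_lt_div (D : ConstructionData X ρ) (hρ0 : 0 < ρ) (hρ1 : ρ < 1 / 4) (n : ℕ) :
    D.η n < ρ / 800000 := by
  have h1 := D.η_lt_mul n
  have h2 := D.t_lt n
  nlinarith

end ConstructionData

namespace ConstructionData.IsLURApproximation

variable {D : ConstructionData X ρ} {N : ℕ → Seminorm ℝ X}

theorem norm_le (h : D.IsLURApproximation N) (hρ0 : 0 < ρ) (hρ1 : ρ < 1 / 4) (n : ℕ) (x : X) :
    ‖x‖ ≤ N n x :=
  ((D.tuple n).norm_le_blueprintNorm hρ0 hρ1 x).trans ((h n).2 x).1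

theorem le_norm (h : D.IsLURApproximation N) (hρ0 : 0 < ρ) (hρ1 : ρ < 1 / 4) (n : ℕ) (x : X) :
    N n x ≤ (1 - ρ / 8)⁻¹ * (1 - ρ)⁻¹ * ‖x‖ := by
  have h1 : 0 < (1 - ρ / 8)⁻¹ := inv_pos.2 (by linarith)
  refine ((h n).2 x).2.trans ?_
  rw [mul_assoc]
  have h2 := (D.tuple n).blueprintNorm_le hρ0 hρ1 x
  have h3 := (D.tuple n).norm_le_blueprintNorm hρ0 hρ1 x
  have h4 := norm_nonneg x
  have h5 : 0 ≤ (D.tuple n).blueprintNorm x := h4.trans h3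
  exact mul_le_mul (D.one_add_η_le n) h2 h5 h1.le

theorem le_one_add_mul_norm (h : D.IsLURApproximation N) {n : ℕ} {x : X}
    (hx : |D.eStar n x| ≤ (1 - ρ) * ‖x‖) : N n x ≤ (1 + D.η n) * ‖x‖ := by
  refine ((h n).2 x).2.trans ?_
  have := D.η_pos n
  gcongr
  exact (D.tuple n).blueprintNorm_le_norm hx

theorem exists_isFinalNorm (h : D.IsLURApproximation N) (hρ0 : 0 < ρ) (hρ1 : ρ < 1 / 4) :
    ∃ p : Seminorm ℝ X, IsFinalNorm ρ N p := by
  have hc : 0 < (1 - ρ / 8)⁻¹ := inv_pos.2 (by linarith)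
  have hd : 1 ≤ (1 - ρ)⁻¹ := (one_le_inv₀ (by linarith)).2 (by linarith)
  let s : X → Set ℝ := fun x => insert ((1 - ρ / 8)⁻¹ * ‖x‖) (range fun n => N n x)
  have hbdd : ∀ x, BddAbove (s x) := fun x => by
    refine ⟨(1 - ρ / 8)⁻¹ * (1 - ρ)⁻¹ * ‖x‖, ?_⟩
    rintro _ (rfl | ⟨n, rfl⟩)
    · have := norm_nonneg x
      gcongr
      exact le_mul_of_one_le_right hc.le hd
    · exact h.le_norm hρ0 hρ1 n x
  have hne : ∀ x, (s x).Nonempty := fun x => insert_nonempty _ _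
  have hbase : ∀ x, (1 - ρ / 8)⁻¹ * ‖x‖ ≤ sSup (s x) := fun x =>
    le_csSup (hbdd x) (mem_insert _ _)
  have hN : ∀ n x, N n x ≤ sSup (s x) := fun n x =>
    le_csSup (hbdd x) (mem_insert_of_mem _ (mem_range_self n))
  refine ⟨Seminorm.ofSMulLE (fun x => sSup (s x)) ?_ ?_ ?_, fun x => isLUB_csSup (hne x) (hbdd x)⟩
  · have : s 0 = {0} := by
      ext r
      simp only [s, norm_zero, mul_zero, map_zero, mem_insert_iff, mem_range, exists_const,
        mem_singleton_iff, eq_comm (a := (0 : ℝ)), or_self]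
    simp [this]
  · intro x y
    refine csSup_le (hne _) ?_
    rintro _ (rfl | ⟨n, rfl⟩)
    · refine le_trans ?_ (add_le_add (hbase x) (hbase y))
      rw [← mul_add]
      gcongr
      exact norm_add_le x y
    · exact (map_add_le_add (N n) x y).trans (add_le_add (hN n x) (hN n y))
  · intro a x
    refine csSup_le (hne _) ?_
    rintro _ (rfl | ⟨n, rfl⟩)
    · rw [norm_smul, mul_left_comm]
      gcongr
      exact hbase x
    · simp only [map_smul_eq_mul]
      gcongr
      exact hN n x

end ConstructionData.IsLURApproximation

namespace IsFinalNorm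

variable {D : ConstructionData X ρ} {N : ℕ → Seminorm ℝ X} {p : Seminorm ℝ X}

theorem mul_norm_le (hp : IsFinalNorm ρ N p) (x : X) : (1 - ρ / 8)⁻¹ * ‖x‖ ≤ p x :=
  (hp x).1 (mem_insert _ _)

theorem approx_le (hp : IsFinalNorm ρ N p) (n : ℕ) (x : X) : N n x ≤ p x :=
  (hp x).1 (mem_insert_of_mem _ (mem_range_self n))

theorem le_of_forall_le (hp : IsFinalNorm ρ N p) {x : X} {r : ℝ}
    (h1 : (1 - ρ / 8)⁻¹ * ‖x‖ ≤ r) (h2 : ∀ n, N n x ≤ r) : p x ≤ r :=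
  (hp x).2 (by rintro _ (rfl | ⟨n, rfl⟩); exacts [h1, h2 n])

theorem le_mul_norm (hp : IsFinalNorm ρ N p) (h : D.IsLURApproximation N) (hρ0 : 0 < ρ)
    (hρ1 : ρ < 1 / 4) (x : X) : p x ≤ (1 - ρ / 8)⁻¹ * (1 - ρ)⁻¹ * ‖x‖ := by
  have hc : 0 < (1 - ρ / 8)⁻¹ := inv_pos.2 (by linarith)
  have hd : 1 ≤ (1 - ρ)⁻¹ := (one_le_inv₀ (by linarith)).2 (by linarith)
  refine hp.le_of_forall_le ?_ fun n => h.le_norm hρ0 hρ1 n x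
  gcongr
  exact le_mul_of_one_le_right hc.le hd

theorem norm_le (hp : IsFinalNorm ρ N p) (hρ0 : 0 < ρ) (hρ1 : ρ < 1 / 4) (x : X) :
    ‖x‖ ≤ p x :=
  (le_mul_of_one_le_left (norm_nonneg x)
    ((one_le_inv₀ (by linarith)).2 (by linarith))).trans (hp.mul_norm_le x)

theorem le_two_mul_norm (hp : IsFinalNorm ρ N p) (h : D.IsLURApproximation N) (hρ0 : 0 < ρ)
    (hρ1 : ρ < 1 / 4) (x : X) : p x ≤ 2 * ‖x‖ := by
  refine (hp.le_mul_norm h hρ0 hρ1 x).trans ?_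
  gcongr
  rw [← mul_inv]
  exact inv_le_of_inv_le₀ (by norm_num) (by nlinarith)

theorem locallyUniformlyConvex (hp : IsFinalNorm ρ N p) (h : D.IsLURApproximation N) (hρ0 : 0 < ρ)
    (hρ1 : ρ < 1 / 4) (hX : LocallyUniformlyConvex X) : LocallyUniformlyConvex (Renormed p) := by
  refine locallyUniformlyConvex_of_forall_exists_pos fun (x : X) (hx : p x = 1) ε hε => ?_
  change ∃ δ > 0, ∀ y : X, p y = 1 → 1 - δ < p ((1 / 2 : ℝ) • (x + y)) → p (x - y) < ε
  have hc0 : 0 < (1 - ρ / 8)⁻¹ := inv_pos.2 (by linarith)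
  have hc1 : 1 ≤ (1 - ρ / 8)⁻¹ := (one_le_inv₀ (by linarith)).2 (by linarith)
  have hxle : ‖x‖ ≤ 1 - ρ / 8 := by
    have := hp.mul_norm_le x
    rwa [hx, inv_mul_le_iff₀ (by linarith), mul_one] at this
  have hx0 : 0 < ‖x‖ := by linarith [hp.le_two_mul_norm h hρ0 hρ1 x]
  -- From some index on, `x` is outside the cone over the slices, so `N n x` is at most `(1 + η n) *
  -- ‖x‖`, which is bounded away from 1.
  have hev : ∀ᶠ n in atTop, |D.eStar n x| ≤ (1 - ρ) * ‖x‖ := by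
    have h1 := (D.weakStar_null x).abs
    rw [abs_zero] at h1
    exact h1.eventually (ge_mem_nhds (mul_pos (by linarith) hx0))
  obtain ⟨n₀, hn₀⟩ := eventually_atTop.1 hev
  have hbase : ∀ᶠ δ in 𝓝[>] (0 : ℝ), ∀ y : X,
      2 * ‖x‖ ^ 2 + 2 * ‖y‖ ^ 2 - ‖x + y‖ ^ 2 < δ → p (x - y) < ε := by
    obtain ⟨δ, hδ, H⟩ := hX.exists_pos_forall_norm_sub_lt x (half_pos hε)
    filter_upwards [Ioo_mem_nhdsGT hδ] with δ' hδ' y hy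
    linarith [H y (hy.trans hδ'.2), hp.le_two_mul_norm h hρ0 hρ1 (x - y)]
  have hN : ∀ᶠ δ in 𝓝[>] (0 : ℝ), ∀ n ∈ Finset.range n₀, ∀ y : X,
      2 * N n x ^ 2 + 2 * N n y ^ 2 - N n (x + y) ^ 2 < δ → p (x - y) < ε := by
    rw [Filter.eventually_all_finset]
    intro n _
    obtain ⟨δ, hδ, H⟩ := (h n).1.exists_pos_forall_norm_sub_lt (toRenormed (N n) x) (half_pos hε)
    filter_upwards [Ioo_mem_nhdsGT hδ] with δ' hδ' y hy
    have h1 : N n (x - y) < ε / 2 := H (toRenormed (N n) y) (hy.trans hδ'.2)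
    linarith [h.norm_le hρ0 hρ1 n (x - y), hp.le_two_mul_norm h hρ0 hρ1 (x - y)]
  obtain ⟨δ, hδb, hδN, hδ⟩ := (hbase.and (hN.and self_mem_nhdsWithin)).exists
  replace hδ : 0 < δ := hδ
  -- `δ / 8` makes the deficit smaller than `δ`. `ρ / 32` rules out the tail, where the midpoint
  -- value is at most about $1-\rho/16$.
  refine ⟨min (min (δ / 8) (ρ / 32)) 1, by positivity, fun y hy hxy => ?_⟩
  obtain ⟨hδ1, hδ2, hδ3⟩ : min (min (δ / 8) (ρ / 32)) 1 ≤ δ / 8 ∧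
      min (min (δ / 8) (ρ / 32)) 1 ≤ ρ / 32 ∧ min (min (δ / 8) (ρ / 32)) 1 ≤ 1 :=
    ⟨(min_le_left _ _).trans (min_le_left _ _), (min_le_left _ _).trans (min_le_right _ _),
      min_le_right _ _⟩
  have hδ0 : 0 < min (min (δ / 8) (ρ / 32)) 1 := by positivity
  generalize min (min (δ / 8) (ρ / 32)) 1 = r at hxy hδ1 hδ2 hδ3 hδ0
  have key : ∀ a b c : ℝ, 0 ≤ a → a ≤ 1 → 0 ≤ b → b ≤ 1 → 1 - r < 1 / 2 * c →
      2 * a ^ 2 + 2 * b ^ 2 - c ^ 2 < δ := fun a b c ha0 ha1 hb0 hb1 hc => by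
    have h1 : (1 - r) ^ 2 < (1 / 2 * c) ^ 2 := by
      apply pow_lt_pow_left₀ hc (by linarith) (by norm_num)
    nlinarith
  obtain ⟨s, hs, hs'⟩ := (lt_isLUB_iff (hp _)).1 hxy
  rcases hs with rfl | ⟨n, rfl⟩
  · rw [norm_smul, show ‖(1 / 2 : ℝ)‖ = 1 / 2 by norm_num] at hs'
    have h1 := hp.mul_norm_le x
    have h2 := hp.mul_norm_le y
    rw [hx] at h1
    rw [hy] at h2
    have h3 := key ((1 - ρ / 8)⁻¹ * ‖x‖) ((1 - ρ / 8)⁻¹ * ‖y‖) ((1 - ρ / 8)⁻¹ * ‖x + y‖)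
      (by positivity) h1 (by positivity) h2 (by linarith)
    refine hδb y (lt_of_le_of_lt ?_ h3)
    have h4 := (normSeminorm ℝ X).sq_add_sq_sub_sq_nonneg x y
    simp only [coe_normSeminorm] at h4
    -- The unscaled deficit is no larger than the scaled one, because $(1-\rho/8)^{-2}\ge1$.
    nlinarith [mul_nonneg h4 (show 0 ≤ (1 - ρ / 8)⁻¹ ^ 2 - 1 by nlinarith)]
  · simp only [map_smul_eq_mul, show ‖(1 / 2 : ℝ)‖ = 1 / 2 by norm_num] at hs'
    have h1 := hp.approx_le n x
    have h2 := hp.approx_le n y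
    rw [hx] at h1
    rw [hy] at h2
    rcases lt_or_ge n n₀ with hn | hn
    · exact hδN n (Finset.mem_range.2 hn) y
        (key _ _ _ (apply_nonneg _ _) h1 (apply_nonneg _ _) h2 hs')
    · exfalso
      have h3 := h.le_one_add_mul_norm (hn₀ n hn)
      have h4 := D.η_lt_div hρ0 hρ1 n
      have h5 := map_add_le_add (N n) x y
      have h6 : (1 + D.η n) * ‖x‖ ≤ (1 + ρ / 800000) * (1 - ρ / 8) := by gcongr
      nlinarith

theorem exists_continuousLinearEquiv (hp : IsFinalNorm ρ N p) (h : D.IsLURApproximation N)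
    (hρ0 : 0 < ρ) (hρ1 : ρ < 1 / 4) :
    ∃ T : X ≃L[ℝ] Renormed p, (∀ x, T x = toRenormed p x) ∧
      ‖(T : X →L[ℝ] Renormed p)‖ * ‖(T.symm : Renormed p →L[ℝ] X)‖ ≤ (1 - ρ)⁻¹ := by
  have hc : 0 < 1 - ρ / 8 := by linarith
  have hd : 0 < 1 - ρ := by linarith
  have h1 : ∀ x, ‖toRenormed p x‖ ≤ (1 - ρ / 8)⁻¹ * (1 - ρ)⁻¹ * ‖x‖ := hp.le_mul_norm h hρ0 hρ1
  have h2 : ∀ x, ‖(toRenormed p).symm x‖ ≤ (1 - ρ / 8) * ‖x‖ := fun x => by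
    have := hp.mul_norm_le ((toRenormed p).symm x)
    rwa [inv_mul_le_iff₀ hc] at this
  refine ⟨(toRenormed p).toContinuousLinearEquivOfBounds _ _ h1 h2, fun x => rfl, ?_⟩
  have h3 : ‖(((toRenormed p).toContinuousLinearEquivOfBounds _ _ h1 h2 : X ≃L[ℝ] Renormed p) :
      X →L[ℝ] Renormed p)‖ ≤ (1 - ρ / 8)⁻¹ * (1 - ρ)⁻¹ :=
    ContinuousLinearMap.opNorm_le_bound _ (by positivity) h1
  have h4 : ‖(((toRenormed p).toContinuousLinearEquivOfBounds _ _ h1 h2).symm :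
      Renormed p →L[ℝ] X)‖ ≤ 1 - ρ / 8 :=
    ContinuousLinearMap.opNorm_le_bound _ hc.le h2
  refine (mul_le_mul h3 h4 (norm_nonneg _) (by positivity)).trans_eq ?_
  rw [mul_right_comm, inv_mul_cancel₀ hc.ne', one_mul]

end IsFinalNorm

end FinalNorm

/-! ### Nearest point maps in LUR spaces. -/

section NearestPoint

theorem IsNearestPointMap.norm_sub_le {E : Type*} [SeminormedAddCommGroup E] {K : Set E}
    {R : E → K} (hR : IsNearestPointMap K R) {x y : E} (hy : y ∈ K) :
    ‖x - R x‖ ≤ ‖x - y‖ := by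
  rw [← dist_eq_norm, ← dist_eq_norm, hR x]
  exact Metric.infDist_le_dist_of_mem hy

variable {E : Type*} [SeminormedAddCommGroup E] [NormedSpace ℝ E] {K : Set E}

/-- In a locally uniformly convex space, almost nearest points of a convex set are close to the
nearest point. -/
theorem LocallyUniformlyConvex.exists_pos_forall_almost_nearest (hE : LocallyUniformlyConvex E)
    (hK : Convex ℝ K) {x u : E} (hu : u ∈ K) (hmin : ∀ w ∈ K, ‖x - u‖ ≤ ‖x - w‖) {ε : ℝ}
    (hε : 0 < ε) : ∃ δ > 0, ∀ w ∈ K, ‖x - w‖ < ‖x - u‖ + δ → ‖u - w‖ < ε := by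
  obtain ⟨δ, hδ, H⟩ := hE.exists_pos_forall_norm_sub_lt (x - u) hε
  have hlim : Tendsto (fun s : ℝ => 2 * ((‖x - u‖ + s) ^ 2 - ‖x - u‖ ^ 2)) (𝓝[>] 0) (𝓝 0) := by
    have : Continuous fun s : ℝ => 2 * ((‖x - u‖ + s) ^ 2 - ‖x - u‖ ^ 2) := by fun_prop
    have h1 := this.tendsto 0
    simp only [add_zero, sub_self, mul_zero] at h1
    exact h1.mono_left nhdsWithin_le_nhds
  obtain ⟨s, hs, hs0⟩ := ((hlim.eventually (gt_mem_nhds hδ)).and self_mem_nhdsWithin).exists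
  replace hs0 : 0 < s := hs0
  refine ⟨s, hs0, fun w hw hws => ?_⟩
  -- The midpoint is no closer to `x` than `u` is, which bounds the norm of $(x-u)+(x-w)$ below by
  -- $2\|x-u\|$ and hence the deficit above.
  have hmid : (1 / 2 : ℝ) • u + (1 / 2 : ℝ) • w ∈ K :=
    hK hu hw (by norm_num) (by norm_num) (by norm_num)
  have h1 := hmin _ hmid
  have h2 : x - u + (x - w) = (2 : ℝ) • (x - ((1 / 2 : ℝ) • u + (1 / 2 : ℝ) • w)) := by module
  have h3 : 2 * ‖x - u‖ ≤ ‖x - u + (x - w)‖ := by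
    rw [h2, norm_smul, Real.norm_of_nonneg (by norm_num : (0 : ℝ) ≤ 2)]
    linarith
  have h4 : (2 * ‖x - u‖) ^ 2 ≤ ‖x - u + (x - w)‖ ^ 2 := by gcongr
  have h5 : ‖x - w‖ ^ 2 ≤ (‖x - u‖ + s) ^ 2 := by gcongr
  have h6 := H (x - w) (by nlinarith)
  rwa [sub_sub_sub_cancel_left, norm_sub_rev] at h6

/-- A second nearest point is almost nearest for every tolerance, hence at distance zero from the
first. `hsep` turns this into equality, since `Renormed p` carries only a seminorm structure. -/
theorem LocallyUniformlyConvex.existsUnique_isNearestPointMap (hE : LocallyUniformlyConvex E)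
    (hsep : ∀ x : E, ‖x‖ = 0 → x = 0) (hK : IsCompact K) (hconv : Convex ℝ K)
    (hne : K.Nonempty) : ∃! R : E → K, IsNearestPointMap K R := by
  choose R hRK hR using fun x => hK.exists_infDist_eq_dist hne x
  refine ⟨fun x => ⟨R x, hRK x⟩, fun x => (hR x).symm, fun R' hR' => ?_⟩
  funext x
  refine Subtype.ext (sub_eq_zero.1 (hsep _ ?_))
  by_contra hpos
  have hpos' : 0 < ‖(R' x : E) - R x‖ := lt_of_le_of_ne (norm_nonneg _) (Ne.symm hpos)
  obtain ⟨δ, hδ, H⟩ := hE.exists_pos_forall_almost_nearest hconv (R' x).2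
    (fun w hw => hR'.norm_sub_le hw) hpos'
  refine lt_irrefl _ (H (R x) (hRK x) ?_)
  rw [← dist_eq_norm, ← dist_eq_norm, hR' x, hR x]
  linarith

theorem LocallyUniformlyConvex.continuous_of_isNearestPointMap (hE : LocallyUniformlyConvex E)
    (hconv : Convex ℝ K) {R : E → K} (hR : IsNearestPointMap K R) : Continuous R := by
  rw [Metric.continuous_iff]
  intro x ε hε
  obtain ⟨δ, hδ, H⟩ := hE.exists_pos_forall_almost_nearest hconv (R x).2
    (fun w hw => hR.norm_sub_le hw) hε
  refine ⟨δ / 2, half_pos hδ, fun y hy => ?_⟩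
  rw [dist_comm, Subtype.dist_eq, dist_eq_norm]
  refine H _ (R y).2 ?_
  have h1 : ‖y - R y‖ ≤ ‖y - R x‖ := hR.norm_sub_le (R x).2
  have h2 : ‖x - R y‖ ≤ ‖x - y‖ + ‖y - R y‖ := norm_sub_le_norm_sub_add_norm_sub _ _ _
  have h3 : ‖y - R x‖ ≤ ‖y - x‖ + ‖x - R x‖ := norm_sub_le_norm_sub_add_norm_sub _ _ _
  rw [dist_eq_norm] at hy
  rw [norm_sub_rev x y] at h2
  linarith

end NearestPoint

/-! ### Failure of uniform continuity. -/

theorem eventually_forall_abs_le_of_isCompact {X : Type*} [NormedAddCommGroup X]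
    [NormedSpace ℝ X] {f : ℕ → StrongDual ℝ X} (hf : ∀ n, ‖f n‖ ≤ 1)
    (hlim : ∀ x, Tendsto (fun n => f n x) atTop (𝓝 0)) {K : Set X} (hK : IsCompact K) {η : ℝ}
    (hη : 0 < η) : ∀ᶠ n in atTop, ∀ w ∈ K, |f n w| ≤ η := by
  obtain ⟨s, -, hs, hcov⟩ := hK.finite_cover_balls (half_pos hη)
  have h1 : ∀ᶠ n in atTop, ∀ x ∈ s, |f n x| < η / 2 := by
    rw [Filter.eventually_all_finite hs]
    intro x _
    have := (hlim x).abs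
    rw [abs_zero] at this
    exact this.eventually (gt_mem_nhds (half_pos hη))
  filter_upwards [h1] with n hn w hw
  obtain ⟨x, hx, hwx⟩ := mem_iUnion₂.1 (hcov hw)
  rw [mem_ball_iff_norm] at hwx
  have h2 : |f n (w - x)| ≤ 1 * ‖w - x‖ := (f n).le_of_opNorm_le (hf n) _
  have h3 : f n w = f n (w - x) + f n x := by rw [map_sub]; ring
  rw [h3]
  refine (abs_add_le _ _).trans ?_
  linarith [hn x hx]

section NonUniform

variable {X : Type*} [NormedAddCommGroup X] [NormedSpace ℝ X] {ρ : ℝ}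

namespace BlueprintTuple

/-- Strong exposure of $y^+$: the left side is convex in `z` and the right side affine, so
generators suffice. For all generators except $y^\pm$, the gap in $e^*$ of nearly $\rho/2$ outweighs
everything else. At $y^-$ the $h^*$ term gives almost $\rho$, against a distance of at most
$2t+\rho/2<5\rho/8$. -/
theorem norm_sub_yPlus_le (α : BlueprintTuple X ρ) (hρ0 : 0 < ρ) (hρ1 : ρ < 1 / 4) {η : ℝ}
    (hη0 : 0 ≤ η) (hη : η ≤ α.t * ρ / 12800) (hve : ρ / 4 * |α.eStar α.v| ≤ 2 * η)
    (hvh : ρ / 4 * |α.hStar α.v| ≤ 2 * η) {z : X} (hz : z ∈ α.ball) :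
    ‖z - α.yPlus‖ ≤ 4 / α.t * α.eStar (α.yPlus - z) + ρ / (2 * α.t) * α.hStar (α.yPlus - z) := by
  have ht := α.t_pos
  have ht' := α.t_lt
  have hy := α.norm_yPlus_le hρ0 hρ1
  have hη' : η / α.t ≤ ρ / 12800 := by rw [div_le_iff₀ ht]; linarith
  have hηt : 0 ≤ η / α.t := by positivity
  have hρt : 16 ≤ ρ / α.t := by rw [le_div_iff₀ ht]; linarith
  have he : α.eStar α.yPlus =
      (1 - ρ / 2) + α.t * α.eStar α.h + ρ / 4 * α.eStar α.v := by
    simp [yPlus, xPlus, α.eStar_e]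
  obtain ⟨hh1, hh2⟩ := abs_lt.1 α.eStar_h
  have hve' : |ρ / 4 * α.eStar α.v| ≤ 2 * η := by
    rwa [abs_mul, abs_of_pos (by positivity : 0 < ρ / 4)]
  have hvh' : |ρ / 4 * α.hStar α.v| ≤ 2 * η := by
    rwa [abs_mul, abs_of_pos (by positivity : 0 < ρ / 4)]
  obtain ⟨hve1, hve2⟩ := abs_le.1 hve'
  obtain ⟨hvh1, hvh2⟩ := abs_le.1 hvh'
  have hflat : ∀ g : X, ‖g‖ ≤ 1 → α.eStar g ≤ 1 - ρ → ‖g - α.yPlus‖ ≤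
      4 / α.t * α.eStar (α.yPlus - g) + ρ / (2 * α.t) * α.hStar (α.yPlus - g) := by
    intro g hg1 hg2
    have h1 : ‖g - α.yPlus‖ ≤ 2 := (norm_sub_le _ _).trans (by linarith)
    have h2 : ρ * (49 / 100) ≤ α.eStar (α.yPlus - g) := by
      rw [map_sub, he]; nlinarith
    have h3 : -2 ≤ α.hStar (α.yPlus - g) := by
      have := (abs_le.1 (α.hStar_le_norm (α.yPlus - g))).1
      rw [norm_sub_rev] at this
      linarith
    have h4 : 4 / α.t * (ρ * (49 / 100)) ≤ 4 / α.t * α.eStar (α.yPlus - g) := by gcongr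
    have h5 : ρ / (2 * α.t) * (-2) ≤ ρ / (2 * α.t) * α.hStar (α.yPlus - g) := by gcongr
    have h6 : 4 / α.t * (ρ * (49 / 100)) = 196 / 100 * (ρ / α.t) := by ring
    have h7 : ρ / (2 * α.t) * (-2) = -(ρ / α.t) := by field_simp
    linarith
  have hconv : Convex ℝ {z : X | ‖z - α.yPlus‖ ≤
      4 / α.t * α.eStar (α.yPlus - z) + ρ / (2 * α.t) * α.hStar (α.yPlus - z)} := by
    intro a ha b hb r s hr hs hrs
    simp only [mem_ofPred_eq] at ha hb ⊢
    have h1 : r • a + s • b - α.yPlus = r • (a - α.yPlus) + s • (b - α.yPlus) := by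
      obtain rfl : s = 1 - r := by linarith
      module
    have h2 : α.yPlus - (r • a + s • b) = r • (α.yPlus - a) + s • (α.yPlus - b) := by
      obtain rfl : s = 1 - r := by linarith
      module
    rw [h1, h2]
    refine (norm_add_le _ _).trans ?_
    rw [norm_smul, norm_smul, Real.norm_of_nonneg hr, Real.norm_of_nonneg hs]
    simp only [map_add, map_smul, smul_eq_mul]
    nlinarith [mul_le_mul_of_nonneg_left ha hr, mul_le_mul_of_nonneg_left hb hs]
  have hsub : α.yPlus - α.yMinus = (2 * α.t) • α.h + (ρ / 2) • α.v := by
    simp only [yPlus, yMinus, xPlus, xMinus]; module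
  refine convexHull_min ?_ hconv hz
  rintro g (hg | rfl | rfl | rfl | rfl)
  · rw [α.mem_diff_slice_iff] at hg
    exact hflat g hg.1 (abs_le.1 hg.2).2
  · simp
  · rw [mem_ofPred_eq, norm_sub_rev, hsub]
    have h1 : ‖(2 * α.t) • α.h + (ρ / 2) • α.v‖ ≤ 2 * α.t + ρ / 2 := by
      refine (norm_add_le _ _).trans ?_
      rw [norm_smul, norm_smul, α.norm_h, α.norm_v, Real.norm_of_nonneg (by linarith),
        Real.norm_of_nonneg (by linarith)]
      linarith
    simp only [map_add, map_smul, smul_eq_mul, α.hStar_h]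
    have h2 : -(α.t * (ρ / 400) + 4 * η) ≤ 2 * α.t * α.eStar α.h + ρ / 2 * α.eStar α.v := by
      nlinarith
    have h3 : 2 * α.t - 4 * η ≤ 2 * α.t * 1 + ρ / 2 * α.hStar α.v := by nlinarith
    have h4 := mul_le_mul_of_nonneg_left h2 (show 0 ≤ 4 / α.t by positivity)
    have h5 := mul_le_mul_of_nonneg_left h3 (show 0 ≤ ρ / (2 * α.t) by positivity)
    have h6 : 4 / α.t * -(α.t * (ρ / 400) + 4 * η) = -(ρ / 100) - 16 * (η / α.t) := by
      field_simp; ring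
    have h7 : ρ / (2 * α.t) * (2 * α.t - 4 * η) = ρ - 2 * ρ * (η / α.t) := by
      field_simp; ring
    nlinarith
  · exact hflat _ (by rw [norm_neg]; linarith) (by rw [map_neg, he]; nlinarith)
  · have h1 := α.norm_yMinus_le hρ0 hρ1
    have he' : α.eStar α.yMinus =
        (1 - ρ / 2) - α.t * α.eStar α.h - ρ / 4 * α.eStar α.v := by
      simp [yMinus, xMinus, α.eStar_e]
    exact hflat _ (by rw [norm_neg]; linarith) (by rw [map_neg, he']; nlinarith)

/-- A point `w` for which `x⁺ - w` almost lies in the blueprint ball is close to `-(ρ/4) v`, if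
`e*` and `h*` are small on `w` and on `v`. -/
theorem norm_add_smul_v_le (α : BlueprintTuple X ρ) (hρ0 : 0 < ρ) (hρ1 : ρ < 1 / 4) {η : ℝ}
    (hη0 : 0 < η) (hη : η ≤ α.t * ρ / 12800) (hve : ρ / 4 * |α.eStar α.v| ≤ 2 * η)
    (hvh : ρ / 4 * |α.hStar α.v| ≤ 2 * η) {w : X} (hwe : |α.eStar w| ≤ η)
    (hwh : |α.hStar w| ≤ η) (hw : α.blueprintNorm (α.xPlus - w) ≤ 1 + 2 * η) :
    ‖w + (ρ / 4) • α.v‖ ≤ ρ / 100 := by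
  have ht := α.t_pos
  have ht' := α.t_lt
  have hηt : η / α.t ≤ ρ / 12800 := by rw [div_le_iff₀ ht]; linarith
  have hηρ : η ≤ ρ / 12800 := by nlinarith
  -- Enlarging $2\eta$ to $3\eta$ makes the gauge inequality strict, so that `z` lies in the ball
  -- itself.
  obtain ⟨z, hz, hxz⟩ := α.exists_smul_mem_ball hρ0 hρ1 (r := 1 + 3 * η)
    (hw.trans_lt (by linarith))
  have hz1 : ‖z‖ ≤ 1 := by simpa using α.ball_subset_closedBall hρ0 hρ1 hz
  have key := α.norm_sub_yPlus_le hρ0 hρ1 hη0.le hη hve hvh hz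
  have hdecomp : α.yPlus - z = (w + (ρ / 4) • α.v) + (3 * η) • z := by
    have h1 : α.yPlus = (α.xPlus - w) + w + (ρ / 4) • α.v := by rw [yPlus]; abel
    rw [h1, hxz]; module
  -- The bound $6\eta$ collects $\eta$ from `w`, $2\eta$ from $\frac\rho4 v$ and $3\eta$ from
  -- rescaling `z`.
  have hfun : ∀ f : StrongDual ℝ X, (∀ x, |f x| ≤ ‖x‖) → |f w| ≤ η →
      ρ / 4 * |f α.v| ≤ 2 * η → f (α.yPlus - z) ≤ 6 * η := by
    intro f hf h1 h2
    rw [hdecomp, map_add, map_add, map_smul, map_smul, smul_eq_mul, smul_eq_mul]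
    have h3 := (le_abs_self _).trans (hf z)
    have h4 := le_abs_self (f w)
    have h5 : ρ / 4 * f α.v ≤ ρ / 4 * |f α.v| := by gcongr; exact le_abs_self _
    nlinarith
  have h1 := mul_le_mul_of_nonneg_left (hfun α.eStar α.eStar_le_norm hwe hve)
    (show 0 ≤ 4 / α.t by positivity)
  have h2 := mul_le_mul_of_nonneg_left (hfun α.hStar α.hStar_le_norm hwh hvh)
    (show 0 ≤ ρ / (2 * α.t) by positivity)
  have h3 : 4 / α.t * (6 * η) = 24 * (η / α.t) := by ring
  have h4 : ρ / (2 * α.t) * (6 * η) = 3 * ρ * (η / α.t) := by field_simp; ring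
  have h5 : w + (ρ / 4) • α.v = (α.yPlus - z) - (3 * η) • z := by rw [hdecomp]; abel
  rw [h5]
  refine (norm_sub_le _ _).trans ?_
  rw [norm_sub_rev, norm_smul, Real.norm_of_nonneg (by linarith)]
  have h6 : 0 ≤ η / α.t := by positivity
  nlinarith

/-- Applies the localisation to a nearest point `w`: the competitor $-\frac\rho4 v$ gives a vector
within $\frac\rho4\eta$ of $y^+$, so $p(x^+-w)\le1+2\eta$. The prescribed direction `v` replaces the
nearby `α.v`. -/
theorem norm_add_smul_le_of_le (α : BlueprintTuple X ρ) (hρ0 : 0 < ρ) (hρ1 : ρ < 1 / 4) {η : ℝ}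
    (hη0 : 0 < η) (hη : η ≤ α.t * ρ / 12800) {p : Seminorm ℝ X}
    (hαp : ∀ x, α.blueprintNorm x ≤ p x) (hp : ∀ x, p x ≤ 2 * ‖x‖) (hy : p α.yPlus ≤ 1 + η)
    {v w : X} (hv : ‖α.v - v‖ ≤ η) (hve : |α.eStar ((ρ / 4) • v)| ≤ η)
    (hvh : |α.hStar ((ρ / 4) • v)| ≤ η) (hwe : |α.eStar w| ≤ η) (hwh : |α.hStar w| ≤ η)
    (hw : p (α.xPlus - w) ≤ p (α.xPlus + (ρ / 4) • v)) : ‖w + (ρ / 4) • v‖ ≤ ρ / 50 := by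
  have hfun : ∀ f : StrongDual ℝ X, (∀ x, |f x| ≤ ‖x‖) → |f ((ρ / 4) • v)| ≤ η →
      ρ / 4 * |f α.v| ≤ 2 * η := by
    intro f hf h1
    have h2 : |f α.v| ≤ |f v| + |f (α.v - v)| := by
      have h3 : f α.v = f v + f (α.v - v) := by rw [map_sub]; ring
      rw [h3]
      exact abs_add_le _ _
    rw [map_smul, smul_eq_mul, abs_mul, abs_of_pos (by positivity : 0 < ρ / 4)] at h1
    have h4 := (hf (α.v - v)).trans hv
    nlinarith
  have hsmall : ‖(ρ / 4) • (v - α.v)‖ ≤ ρ / 4 * η := by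
    rw [norm_smul, Real.norm_of_nonneg (by positivity), norm_sub_rev]
    gcongr
  have h1 : p (α.xPlus + (ρ / 4) • v) ≤ 1 + 2 * η := by
    have h2 : α.xPlus + (ρ / 4) • v = α.yPlus + (ρ / 4) • (v - α.v) := by rw [yPlus]; module
    rw [h2]
    refine (map_add_le_add p _ _).trans ?_
    have := hp ((ρ / 4) • (v - α.v))
    nlinarith
  have h2 := α.norm_add_smul_v_le hρ0 hρ1 hη0 hη (hfun _ α.eStar_le_norm hve)
    (hfun _ α.hStar_le_norm hvh) hwe hwh ((hαp _).trans (hw.trans h1))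
  have h3 : w + (ρ / 4) • v = (w + (ρ / 4) • α.v) + (ρ / 4) • (v - α.v) := by module
  rw [h3]
  refine (norm_add_le _ _).trans ?_
  have ht := α.t_pos
  have ht' := α.t_lt
  have hηρ : η ≤ ρ / 12800 := by nlinarith
  nlinarith

end BlueprintTuple

/-- The corners of the `n`-th ball are not spoiled by the other norms. Such a `y` is too close to a
multiple of `e n` to enter the cone of any `m ≠ n`, and $\|y\|\le1-3\rho/16$ leaves room for the
factors $1+\eta_m$ and $(1-\rho/8)^{-1}$. -/
theorem IsFinalNorm.le_one_add_η {D : ConstructionData X ρ} {N : ℕ → Seminorm ℝ X}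
    {p : Seminorm ℝ X} (hp : IsFinalNorm ρ N p) (h : D.IsLURApproximation N) (hρ0 : 0 < ρ)
    (hρ1 : ρ < 1 / 4) (n : ℕ) {y r : X} (hball : y ∈ (D.tuple n).ball)
    (hnorm : ‖y‖ ≤ 1 - 3 * ρ / 16) (hyr : y = (1 - ρ / 2) • D.e n + r) (hr : ‖r‖ ≤ 5 * ρ / 16) :
    p y ≤ 1 + D.η n := by
  have hη := D.η_pos n
  have hlow : 1 - ρ / 2 - 5 * ρ / 16 ≤ ‖y‖ := by
    have h1 : ‖(1 - ρ / 2) • D.e n‖ = 1 - ρ / 2 := by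
      rw [norm_smul, D.norm_e, mul_one, Real.norm_of_nonneg (by linarith)]
    have h2 : ‖(1 - ρ / 2) • D.e n‖ ≤ ‖y‖ + ‖r‖ := by
      rw [show (1 - ρ / 2) • D.e n = y - r by rw [hyr]; abel]
      exact norm_sub_le _ _
    linarith
  refine hp.le_of_forall_le ?_ fun m => ?_
  · rw [inv_mul_le_iff₀ (by linarith)]
    nlinarith
  · rcases eq_or_ne m n with rfl | hmn
    · refine ((h m).2 y).2.trans ?_
      nlinarith [(D.tuple m).blueprintNorm_le_one hball]
    · have h1 : |D.eStar m y| ≤ (1 - ρ) * ‖y‖ := by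
        have h2 : |D.eStar m r| ≤ ‖r‖ := by
          simpa [D.norm_eStar] using (D.eStar m).le_opNorm r
        have h3 := D.almost_biorthogonal m n hmn
        have h4 : |D.eStar m y| ≤ (1 - ρ / 2) * |D.eStar m (D.e n)| + |D.eStar m r| := by
          rw [hyr, map_add, map_smul, smul_eq_mul]
          refine (abs_add_le _ _).trans ?_
          rw [abs_mul, abs_of_pos (by linarith : 0 < 1 - ρ / 2)]
        nlinarith [abs_nonneg (D.eStar m (D.e n))]
      have h2 := h.le_one_add_mul_norm h1
      have h3 := D.η_lt_div hρ0 hρ1 m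
      have h4 : (1 + D.η m) * ‖y‖ ≤ (1 + ρ / 800000) * (1 - 3 * ρ / 16) := by
        have := D.η_pos m
        gcongr
      nlinarith

/-- The sphere is connected with more than one point, so it has no isolated points. Near `v` there
is a sphere point avoiding the finitely many `D.v j` with `j < n₀`, and density is applied there to
force a large index. -/
theorem ConstructionData.exists_mem_norm_sub_lt (D : ConstructionData X ρ)
    (hdim : ¬ FiniteDimensional ℝ X) (i n₀ : ℕ) {v : X} (hv : ‖v‖ = 1) {η : ℝ} (hη : 0 < η) :
    ∃ n ∈ D.A i, n₀ ≤ n ∧ ‖D.v n - v‖ < η := by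
  have hrank : 1 < Module.rank ℝ X := by
    by_contra! hcon
    exact hdim (Module.rank_lt_aleph0_iff.1 (hcon.trans_lt Cardinal.one_lt_aleph0))
  have hpre : Preperfect (Metric.sphere (0 : X) 1) := by
    refine IsPreconnected.preperfect_of_nontrivial ⟨v, by simpa, -v, by simpa, fun h => ?_⟩
      (isPreconnected_sphere hrank 0 1)
    have h0 : v = 0 := by
      have h1 : (2 : ℝ) • v = 0 := by rw [two_smul]; nth_rewrite 2 [h]; exact add_neg_cancel v
      simpa using h1
    simp [h0] at hv
  have hacc : AccPt v (𝓟 (Metric.sphere (0 : X) 1)) := hpre v (by simpa)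
  have hfin : (D.v '' Iio n₀ \ {v}).Finite := ((finite_Iio n₀).image _).sdiff
  have h1 : ∀ᶠ x in 𝓝 v, x ∉ D.v '' Iio n₀ \ {v} :=
    hfin.isClosed.isOpen_compl.mem_nhds (by simp)
  have h2 := (accPt_iff_frequently.1 hacc).and_eventually
    (h1.and (Metric.ball_mem_nhds v (half_pos hη)))
  obtain ⟨x, ⟨hxv, hxS⟩, hxF, hxb⟩ := h2.exists
  have hxF' : x ∉ D.v '' Iio n₀ := fun h => hxF ⟨h, hxv⟩
  have hopen : IsOpen ((D.v '' Iio n₀)ᶜ ∩ Metric.ball v (η / 2)) :=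
    (((finite_Iio n₀).image D.v).isClosed.isOpen_compl).inter Metric.isOpen_ball
  obtain ⟨_, ⟨hy1, hy2⟩, n, hn, rfl⟩ :=
    mem_closure_iff.1 (D.v_dense i hxS) _ hopen ⟨hxF', hxb⟩
  refine ⟨n, hn, ?_, ?_⟩
  · by_contra! hlt
    exact hy1 (mem_image_of_mem _ hlt)
  · rw [mem_ball_iff_norm] at hy2
    linarith

theorem IsFinalNorm.exists_close_with_far_nearest {D : ConstructionData X ρ}
    {N : ℕ → Seminorm ℝ X} {p : Seminorm ℝ X} (hp : IsFinalNorm ρ N p)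
    (h : D.IsLURApproximation N) (hdim : ¬ FiniteDimensional ℝ X) (hρ0 : 0 < ρ)
    (hρ1 : ρ < 1 / 4) {K : Set X} (hK : IsCompact K) (hK2 : K.Nontrivial) :
    ∃ c > 0, ∀ δ > 0, ∃ x x' : X, p (x - x') < δ ∧ ∀ u ∈ K, ∀ u' ∈ K,
      (∀ w ∈ K, p (x - u) ≤ p (x - w)) → (∀ w ∈ K, p (x' - u') ≤ p (x' - w)) →
      c ≤ p (u - u') := by
  obtain ⟨a, ha, b, hb, hab⟩ := hK2
  have hL : 0 < ‖a - b‖ := norm_pos_iff.2 (sub_ne_zero.2 hab)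
  refine ⟨‖a - b‖ / 2, half_pos hL, fun δ hδ => ?_⟩
  -- The scale for which $a$ and $b$ are $c\pm r\frac\rho4 v$; `φ` below undoes this similarity.
  set r : ℝ := 2 * ‖a - b‖ / ρ with hr
  have hr0 : 0 < r := by positivity
  set c : X := (1 / 2 : ℝ) • (a + b) with hc
  set v : X := ‖a - b‖⁻¹ • (a - b) with hv
  have hv1 : ‖v‖ = 1 := by rw [hv, norm_smul, norm_inv, norm_norm, inv_mul_cancel₀ hL.ne']
  have hrv : r • (ρ / 4) • v = (1 / 2 : ℝ) • (a - b) := by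
    rw [hv, smul_smul, smul_smul]
    congr 1
    rw [hr]; field_simp; norm_num
  have hac : a = c + r • (ρ / 4) • v := by rw [hrv, hc]; module
  have hbc : b = c + r • (-((ρ / 4) • v)) := by rw [smul_neg, hrv, hc]; module
  let φ : X → X := fun w => r⁻¹ • (w - c)
  have hφ : ∀ w, w = c + r • φ w := fun w => by
    simp only [φ]; rw [smul_inv_smul₀ hr0.ne']; abel
  have hφa : φ a = (ρ / 4) • v := by
    simp only [φ]; rw [hac, add_sub_cancel_left, inv_smul_smul₀ hr0.ne']
  have hφb : φ b = -((ρ / 4) • v) := by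
    simp only [φ]; rw [hbc, add_sub_cancel_left, inv_smul_smul₀ hr0.ne']
  have hφK : IsCompact (φ '' K) := hK.image (by fun_prop)
  -- The block is fixed before the index: it determines the tolerance `D.ε i`, and only then is `n`
  -- in the block taken large enough for that tolerance. This is why `η` is constant on blocks.
  obtain ⟨i, hi⟩ := D.t_small (δ / (4 * r)) (by positivity)
  have hε : 0 < D.ε i := by
    obtain ⟨n, hn⟩ := (D.A_infinite i).nonempty
    rw [← D.η_eq i n hn]
    exact D.η_pos n
  obtain ⟨n₀, hn₀⟩ := eventually_atTop.1 (eventually_forall_abs_le_of_isCompact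
    (fun n => (D.norm_eStar n).le) D.weakStar_null hφK hε)
  obtain ⟨n, hnA, hn, hvn⟩ := D.exists_mem_norm_sub_lt hdim i n₀ hv1 hε
  set α := D.tuple n with hα
  have hηn : D.η n = D.ε i := D.η_eq i n hnA
  have hηt : D.ε i ≤ α.t * ρ / 12800 := by rw [← hηn]; exact (D.η_lt_mul n).le
  have hse : ∀ u ∈ K, |α.eStar (φ u)| ≤ D.ε i := fun u hu => hn₀ n hn _ (mem_image_of_mem φ hu)
  have hsh : ∀ u ∈ K, |α.hStar (φ u)| ≤ D.ε i := fun u hu =>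
    hn₀ (n + 1) (by omega) _ (mem_image_of_mem φ hu)
  have hpα : ∀ x, α.blueprintNorm x ≤ p x := fun x => (((h n).2 x).1).trans (hp.approx_le n x)
  have hp2 := hp.le_two_mul_norm h hρ0 hρ1
  have hrem : ∀ s s' : X, ‖s‖ = 1 → ‖s'‖ = 1 → ‖α.t • s + (ρ / 4) • s'‖ ≤ 5 * ρ / 16 := by
    intro s s' h1 h2
    refine (norm_add_le _ _).trans ?_
    rw [norm_smul, norm_smul, h1, h2, Real.norm_of_nonneg α.t_pos.le,
      Real.norm_of_nonneg (by positivity)]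
    linarith [α.t_lt]
  have hyP : p α.yPlus ≤ 1 + D.ε i := by
    rw [← hηn]
    refine hp.le_one_add_η h hρ0 hρ1 n α.yPlus_mem_ball (α.norm_yPlus_le hρ0 hρ1)
      (r := α.t • α.h + (ρ / 4) • α.v) ?_ (hrem _ _ α.norm_h α.norm_v)
    rw [BlueprintTuple.yPlus, BlueprintTuple.xPlus, add_assoc]
    rfl
  have hyM : p α.flip.yPlus ≤ 1 + D.ε i := by
    rw [← hηn, α.flip_yPlus]
    refine hp.le_one_add_η h hρ0 hρ1 n α.yMinus_mem_ball (α.norm_yMinus_le hρ0 hρ1)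
      (r := α.t • (-α.h) + (ρ / 4) • (-α.v)) ?_
      (hrem _ _ (by rw [norm_neg, α.norm_h]) (by rw [norm_neg, α.norm_v]))
    rw [BlueprintTuple.yMinus, BlueprintTuple.xMinus, smul_neg, smul_neg, ← add_assoc,
      ← sub_eq_add_neg, ← sub_eq_add_neg]
    rfl
  have hpr : ∀ s u : X, p (c + r • s - u) = r * p (s - φ u) := fun s u => by
    conv_lhs => rw [hφ u]
    rw [add_sub_add_left_eq_sub, ← smul_sub, map_smul_eq_mul, Real.norm_of_nonneg hr0.le]
  refine ⟨c + r • α.xPlus, c + r • α.xMinus, ?_, fun u hu u' hu' hun hun' => ?_⟩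
  · rw [add_sub_add_left_eq_sub, ← smul_sub, map_smul_eq_mul, Real.norm_of_nonneg hr0.le]
    have h1 : α.xPlus - α.xMinus = (2 * α.t) • α.h := by
      simp only [BlueprintTuple.xPlus, BlueprintTuple.xMinus]; module
    have h2 := hp2 (α.xPlus - α.xMinus)
    have h4 : ‖(2 * α.t) • α.h‖ = 2 * α.t := by
      rw [norm_smul, α.norm_h, mul_one, Real.norm_of_nonneg (by linarith [α.t_pos])]
    rw [h1, h4] at h2
    have h3 : α.t < δ / (4 * r) := hi n hnA
    rw [lt_div_iff₀ (by positivity)] at h3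
    rw [h1]
    nlinarith
  · have h1 := hun b hb
    rw [hpr, hpr, hφb, sub_neg_eq_add] at h1
    have h2 := hun' a ha
    rw [hpr, hpr, hφa] at h2
    have h3 := α.norm_add_smul_le_of_le hρ0 hρ1 hε hηt hpα hp2 hyP hvn.le
      (hφa ▸ hse a ha) (hφa ▸ hsh a ha) (hse u hu) (hsh u hu) (le_of_mul_le_mul_left h1 hr0)
    -- The flipped tuple exchanges $x^+,y^+$ with $x^-,y^-$; here the competitor is $+\frac\rho4
    -- v=\varphi(a)$.
    have h4 := α.flip.norm_add_smul_le_of_le hρ0 hρ1 hε hηt (v := -v) (w := φ u')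
      (fun x => by
        have := hpα x
        rwa [BlueprintTuple.blueprintNorm, ← α.flip_ball] at this)
      hp2 hyM (by
        change ‖-α.v - -v‖ ≤ _
        rw [← neg_add', norm_neg, ← sub_eq_add_neg]
        exact hvn.le)
      (by
        rw [smul_neg, ← hφb]
        exact hse b hb)
      (by
        rw [smul_neg, ← hφb]
        change |(-α.hStar) _| ≤ _
        rw [neg_apply, abs_neg]
        exact hsh b hb)
      (hse u' hu')
      (by
        change |(-α.hStar) _| ≤ _
        rw [neg_apply, abs_neg]
        exact hsh u' hu')
      (by
        rw [α.flip_xPlus, smul_neg, ← sub_eq_add_neg]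
        exact le_of_mul_le_mul_left h2 hr0)
    refine le_trans ?_ (hp.norm_le hρ0 hρ1 _)
    have h5 : u - u' = r • (φ u - φ u') := by
      conv_lhs => rw [hφ u, hφ u']
      rw [add_sub_add_left_eq_sub, ← smul_sub]
    rw [h5, norm_smul, Real.norm_of_nonneg hr0.le]
    have h6 : (ρ / 2) • v = (φ u + (ρ / 4) • v) - (φ u' + (ρ / 4) • (-v)) - (φ u - φ u') := by
      module
    have h7 : ‖(ρ / 2) • v‖ = ρ / 2 := by
      rw [norm_smul, hv1, mul_one, Real.norm_of_nonneg (by positivity)]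
    have h8 := norm_sub_le ((φ u + (ρ / 4) • v) - (φ u' + (ρ / 4) • (-v))) (φ u - φ u')
    rw [← h6, h7] at h8
    have h9 := norm_sub_le (φ u + (ρ / 4) • v) (φ u' + (ρ / 4) • (-v))
    have h10 : ρ / 4 ≤ ‖φ u - φ u'‖ := by linarith
    calc ‖a - b‖ / 2 = r * (ρ / 4) := by rw [hr]; field_simp; norm_num
      _ ≤ _ := by gcongr

end NonUniform

/-! ### Iterated ultralimits and almost orthogonal vectors. -/

section IteratedLimit

theorem Ultrafilter.tendsto_limUnder_of_forall_mem_Icc {ι : Type*} (U : Ultrafilter ι) {f : ι → ℝ}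
    {a b : ℝ} (hf : ∀ n, f n ∈ Icc a b) :
    Tendsto f U (𝓝 (limUnder (U : Filter ι) f)) ∧ limUnder (U : Filter ι) f ∈ Icc a b := by
  obtain ⟨x, hx, hle⟩ := isCompact_Icc.ultrafilter_le_nhds' (U.map f)
    (Ultrafilter.mem_map.2 (univ_mem' hf))
  have h1 : Tendsto f U (𝓝 (limUnder (U : Filter ι) f)) :=
    tendsto_nhds_limUnder ⟨x, hle⟩
  exact ⟨h1, isClosed_Icc.mem_of_tendsto h1 (Eventually.of_forall hf)⟩

variable {E : Type*} [SeminormedAddCommGroup E] [NormedSpace ℝ E]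

/-- The iterated ultralimit `lim_{n₀} lim_{n₁} ⋯ ‖x + c₀ h_{n₀} + ⋯ + c_{k-1} h_{n_{k-1}}‖`. -/
noncomputable def iterLimNorm (h : ℕ → E) : ℕ → (ℕ → ℝ) → E → ℝ
  | 0, _, x => ‖x‖
  | k + 1, c, x =>
    limUnder (hyperfilter ℕ : Filter ℕ) fun n => iterLimNorm h k (fun i => c (i + 1)) (x + c 0 • h n)

variable {h : ℕ → E} {R : ℝ}

theorem exists_iterLimNorm_mem_Icc (hR : ∀ n, ‖h n‖ ≤ R) (k : ℕ) (c : ℕ → ℝ) :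
    ∃ B, ∀ x, iterLimNorm h k c x ∈ Icc 0 (‖x‖ + B) := by
  induction k generalizing c with
  | zero => exact ⟨0, fun x => by simp [iterLimNorm]⟩
  | succ k ih =>
    obtain ⟨B, hB⟩ := ih fun i => c (i + 1)
    refine ⟨|c 0| * R + B, fun x =>
      (Ultrafilter.tendsto_limUnder_of_forall_mem_Icc _ fun n => ⟨(hB _).1, ?_⟩).2⟩
    refine (hB _).2.trans ?_
    have h1 : ‖x + c 0 • h n‖ ≤ ‖x‖ + |c 0| * R := by
      refine (norm_add_le _ _).trans ?_
      rw [norm_smul, Real.norm_eq_abs]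
      gcongr
      exact hR n
    linarith

theorem tendsto_iterLimNorm_succ (hR : ∀ n, ‖h n‖ ≤ R) (k : ℕ) (c : ℕ → ℝ) (x : E) :
    Tendsto (fun n => iterLimNorm h k (fun i => c (i + 1)) (x + c 0 • h n))
      (hyperfilter ℕ : Filter ℕ) (𝓝 (iterLimNorm h (k + 1) c x)) := by
  obtain ⟨B, hB⟩ := exists_iterLimNorm_mem_Icc hR k fun i => c (i + 1)
  refine (Ultrafilter.tendsto_limUnder_of_forall_mem_Icc (a := 0) (b := ‖x‖ + |c 0| * R + B) _
    fun n => ⟨(hB _).1, (hB _).2.trans ?_⟩).1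
  have h1 : ‖x + c 0 • h n‖ ≤ ‖x‖ + |c 0| * R := by
    refine (norm_add_le _ _).trans ?_
    rw [norm_smul, Real.norm_eq_abs]
    gcongr
    exact hR n
  linarith

theorem iterLimNorm_nonneg (hR : ∀ n, ‖h n‖ ≤ R) (k : ℕ) (c : ℕ → ℝ) (x : E) :
    0 ≤ iterLimNorm h k c x := by
  obtain ⟨B, hB⟩ := exists_iterLimNorm_mem_Icc hR k c
  exact (hB x).1

theorem iterLimNorm_add_le (hR : ∀ n, ‖h n‖ ≤ R) (k : ℕ) (c d : ℕ → ℝ) (x y : E) :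
    iterLimNorm h k (fun i => c i + d i) (x + y) ≤
      iterLimNorm h k c x + iterLimNorm h k d y := by
  induction k generalizing c d x y with
  | zero => exact norm_add_le x y
  | succ k ih =>
    refine le_of_tendsto_of_tendsto' (tendsto_iterLimNorm_succ hR k _ _)
      ((tendsto_iterLimNorm_succ hR k c x).add (tendsto_iterLimNorm_succ hR k d y)) fun n => ?_
    refine le_trans (le_of_eq ?_) (ih _ _ _ _)
    congr 1
    rw [add_smul]; abel

theorem iterLimNorm_smul (hR : ∀ n, ‖h n‖ ≤ R) (k : ℕ) (a : ℝ) (c : ℕ → ℝ) (x : E) :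
    iterLimNorm h k (fun i => a * c i) (a • x) = |a| * iterLimNorm h k c x := by
  induction k generalizing c x with
  | zero => exact norm_smul a x
  | succ k ih =>
    refine tendsto_nhds_unique (tendsto_iterLimNorm_succ hR k _ _)
      (((tendsto_iterLimNorm_succ hR k c x).const_mul |a|).congr fun n => ?_)
    rw [← ih]
    congr 1
    rw [smul_add, smul_smul]

/-- The limit attached to a zero coefficient is constant. Thus only the order of the nonzero
coefficients matters, which makes multiplication by `X` an isometry for `polyLimNorm`. -/
theorem iterLimNorm_skip (hR : ∀ n, ‖h n‖ ≤ R) {j k : ℕ} (hjk : j ≤ k) {c : ℕ → ℝ} (hc : c j = 0)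
    (x : E) :
    iterLimNorm h (k + 1) c x =
      iterLimNorm h k (fun i => if i < j then c i else c (i + 1)) x := by
  induction j generalizing k c x with
  | zero =>
    refine tendsto_nhds_unique (tendsto_iterLimNorm_succ hR k c x) ?_
    simp [hc]
  | succ j ih =>
    obtain ⟨k, rfl⟩ : ∃ k', k = k' + 1 := ⟨k - 1, by omega⟩
    refine tendsto_nhds_unique (tendsto_iterLimNorm_succ hR _ c x)
      ((tendsto_iterLimNorm_succ hR k _ x).congr fun n => ?_)
    rw [ih (by omega) hc]
    simp

/-- Finitely many strict inequalities hold together along the ultrafilter at each level, so one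
choice of indices, hence one `y`, serves all `i ∈ T`. -/
theorem exists_approx_iterLimNorm (hR : ∀ n, ‖h n‖ ≤ R) {G : Submodule ℝ E} (hG : ∀ n, h n ∈ G)
    {ι : Type*} (T : Finset ι) (k : ℕ) (c : ℕ → ℝ) (x : ι → E) (lo hi : ι → ℝ)
    (H : ∀ i ∈ T, iterLimNorm h k c (x i) ∈ Ioo (lo i) (hi i)) :
    ∃ y ∈ G, ∀ i ∈ T, ‖x i + y‖ ∈ Ioo (lo i) (hi i) := by
  induction k generalizing c x with
  | zero => exact ⟨0, G.zero_mem, fun i hi => by simpa [iterLimNorm] using H i hi⟩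
  | succ k ih =>
    have h1 : ∀ᶠ n in (hyperfilter ℕ : Filter ℕ), ∀ i ∈ T,
        iterLimNorm h k (fun i => c (i + 1)) (x i + c 0 • h n) ∈ Ioo (lo i) (hi i) := by
      rw [Filter.eventually_all_finset]
      exact fun i hi => (tendsto_iterLimNorm_succ hR k c (x i)).eventually
        (Ioo_mem_nhds (H i hi).1 (H i hi).2)
    obtain ⟨n, hn⟩ := h1.exists
    obtain ⟨y, hy, hy'⟩ := ih (fun i => c (i + 1)) (fun i => x i + c 0 • h n) hn
    refine ⟨c 0 • h n + y, G.add_mem (G.smul_mem _ (hG n)) hy, fun i hi => ?_⟩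
    rw [← add_assoc]
    exact hy' i hi

open Polynomial in
/-- The iterated ultralimit whose coefficients are those of a polynomial. -/
noncomputable def polyLimNorm (h : ℕ → E) (P : ℝ[X]) (x : E) : ℝ :=
  iterLimNorm h (P.natDegree + 1) P.coeff x

open Polynomial

theorem polyLimNorm_eq (hR : ∀ n, ‖h n‖ ≤ R) (P : ℝ[X]) {k : ℕ} (hk : P.natDegree < k) (x : E) :
    polyLimNorm h P x = iterLimNorm h k P.coeff x := by
  induction k, Nat.succ_le_of_lt hk using Nat.le_induction with
  | base => rfl
  | succ k hk' ih =>
    rw [ih (by omega), iterLimNorm_skip hR le_rfl (P.coeff_eq_zero_of_natDegree_lt (by omega))]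
    congr 1
    funext i
    split_ifs with hi
    · rfl
    · rw [P.coeff_eq_zero_of_natDegree_lt (by omega), P.coeff_eq_zero_of_natDegree_lt (by omega)]

theorem polyLimNorm_add_le (hR : ∀ n, ‖h n‖ ≤ R) (P Q : ℝ[X]) (x y : E) :
    polyLimNorm h (P + Q) (x + y) ≤ polyLimNorm h P x + polyLimNorm h Q y := by
  have h1 := natDegree_add_le P Q
  rw [polyLimNorm_eq hR (P + Q) (k := max P.natDegree Q.natDegree + 1) (by omega),
    polyLimNorm_eq hR P (k := max P.natDegree Q.natDegree + 1) (by omega),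
    polyLimNorm_eq hR Q (k := max P.natDegree Q.natDegree + 1) (by omega)]
  convert iterLimNorm_add_le hR _ P.coeff Q.coeff x y using 2
  funext i
  exact coeff_add P Q i

theorem polyLimNorm_smul (hR : ∀ n, ‖h n‖ ≤ R) (a : ℝ) (P : ℝ[X]) (x : E) :
    polyLimNorm h (a • P) (a • x) = |a| * polyLimNorm h P x := by
  have h1 := natDegree_smul_le a P
  rw [polyLimNorm_eq hR (a • P) (k := P.natDegree + 1) (by omega), polyLimNorm,
    ← iterLimNorm_smul hR]
  rfl

theorem polyLimNorm_neg (hR : ∀ n, ‖h n‖ ≤ R) (P : ℝ[X]) (x : E) :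
    polyLimNorm h (-P) (-x) = polyLimNorm h P x := by
  simpa using polyLimNorm_smul hR (-1) P x

theorem polyLimNorm_X_mul (hR : ∀ n, ‖h n‖ ≤ R) (P : ℝ[X]) (x : E) :
    polyLimNorm h (X * P) x = polyLimNorm h P x := by
  have h1 : (X * P).natDegree ≤ P.natDegree + 1 := by
    refine natDegree_mul_le.trans ?_
    rw [natDegree_X]; omega
  rw [polyLimNorm_eq hR (X * P) (k := P.natDegree + 1 + 1) (by omega), polyLimNorm,
    iterLimNorm_skip hR (Nat.zero_le _) (coeff_X_mul_zero P)]
  simp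

theorem polyLimNorm_neg_X_pow_mul (hR : ∀ n, ‖h n‖ ≤ R) (m : ℕ) (P : ℝ[X]) :
    polyLimNorm h ((-X) ^ m * P) 0 = polyLimNorm h P 0 := by
  induction m with
  | zero => simp
  | succ m ih =>
    rw [pow_succ', mul_assoc, neg_mul, ← neg_zero, polyLimNorm_neg hR, polyLimNorm_X_mul hR,
      neg_zero, ih]

theorem one_le_polyLimNorm_one_sub_X (hR : ∀ n, ‖h n‖ ≤ R)
    (hsep : Pairwise fun m n => 1 ≤ ‖h m - h n‖) : 1 ≤ polyLimNorm h (1 - X) 0 := by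
  have hdeg : (1 - X : ℝ[X]).natDegree < 2 :=
    (natDegree_sub_le _ _).trans_lt (by simp)
  rw [polyLimNorm_eq hR _ hdeg]
  refine ge_of_tendsto' (tendsto_iterLimNorm_succ hR 1 _ _) fun n => ?_
  refine ge_of_tendsto (tendsto_iterLimNorm_succ hR 0 _ _) ?_
  have hne : ∀ᶠ m in (hyperfilter ℕ : Filter ℕ), m ≠ n :=
    hyperfilter_le_cofinite ((finite_singleton n).compl_mem_cofinite)
  filter_upwards [hne] with m hm
  have h1 := hsep hm.symm
  simpa [iterLimNorm, coeff_one, coeff_X, ← sub_eq_add_neg] using h1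

/-- Insert a zero into `P` just after or just before position `j`. Both sequences have the same norm
as `P`, and their difference is the coefficient times $X^j-X^{j+1}$. -/
theorem abs_coeff_mul_le_polyLimNorm (hR : ∀ n, ‖h n‖ ≤ R) (P : ℝ[X]) (j : ℕ) :
    |P.coeff j| * polyLimNorm h (1 - X) 0 ≤ 2 * polyLimNorm h P 0 := by
  rcases lt_or_ge P.natDegree j with hj | hj
  · rw [P.coeff_eq_zero_of_natDegree_lt hj, abs_zero, zero_mul]
    have := iterLimNorm_nonneg hR (P.natDegree + 1) P.coeff 0
    unfold polyLimNorm
    linarith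
  let c₁ : ℕ → ℝ := fun i => if i ≤ j then P.coeff i else if i = j + 1 then 0 else P.coeff (i - 1)
  let c₂ : ℕ → ℝ := fun i => if i < j then P.coeff i else if i = j then 0 else P.coeff (i - 1)
  have h1 : iterLimNorm h (P.natDegree + 1 + 1) c₁ 0 = polyLimNorm h P 0 := by
    rw [iterLimNorm_skip hR (j := j + 1) (by omega) (by simp [c₁]), polyLimNorm]
    congr 1
    funext i
    simp only [c₁]
    split_ifs <;> first | rfl | omega
  have h2 : iterLimNorm h (P.natDegree + 1 + 1) c₂ 0 = polyLimNorm h P 0 := by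
    rw [iterLimNorm_skip hR (j := j) (by omega) (by simp [c₂]), polyLimNorm]
    congr 1
    funext i
    simp only [c₂]
    split_ifs <;> first | rfl | omega
  have h3 := iterLimNorm_add_le hR (P.natDegree + 1 + 1) c₁ (fun i => -1 * c₂ i) 0 ((-1 : ℝ) • 0)
  rw [iterLimNorm_smul hR, h1, h2] at h3
  have h4 : polyLimNorm h (P.coeff j • (X ^ j * (1 - X))) 0 =
      |P.coeff j| * polyLimNorm h (1 - X) 0 := by
    have h5 : ∀ m : ℕ, polyLimNorm h (X ^ m * (1 - X)) 0 = polyLimNorm h (1 - X) 0 := fun m => by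
      induction m with
      | zero => simp
      | succ m ih => rw [pow_succ', mul_assoc, polyLimNorm_X_mul hR, ih]
    rw [← h5 j, ← polyLimNorm_smul hR, smul_zero]
  have hdeg : (P.coeff j • (X ^ j * (1 - X : ℝ[X]))).natDegree < P.natDegree + 1 + 1 := by
    refine (natDegree_smul_le _ _).trans_lt (natDegree_mul_le.trans_lt ?_)
    have h6 : (1 - X : ℝ[X]).natDegree ≤ 1 := (natDegree_sub_le _ _).trans (by simp)
    rw [natDegree_X_pow]
    omega
  rw [← h4, polyLimNorm_eq hR _ hdeg]
  refine le_trans (le_of_eq ?_) (h3.trans_eq (by norm_num; ring))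
  rw [smul_zero, add_zero]
  congr 1
  funext i
  simp only [coeff_smul, smul_eq_mul, mul_sub, mul_one, ← pow_succ, coeff_sub, coeff_X_pow, c₁, c₂]
  rcases lt_trichotomy i j with hi | rfl | hi
  · simp [hi, hi.le, hi.ne, (show i ≠ j + 1 by omega)]
  · simp
  · rcases eq_or_ne i (j + 1) with rfl | hi'
    · simp
    · simp [hi', hi.ne', hi.not_gt, hi.not_ge]

/-- Multiplication by `1 + X` is not bounded below for `polyLimNorm`. -/
theorem exists_polyLimNorm_one_add_X_mul_le (hR : ∀ n, ‖h n‖ ≤ R)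
    (hsep : Pairwise fun m n => 1 ≤ ‖h m - h n‖) {δ : ℝ} (hδ : 0 < δ) :
    ∃ P : ℝ[X], 0 < polyLimNorm h P 0 ∧
      polyLimNorm h ((1 + X) * P) 0 ≤ δ * polyLimNorm h P 0 := by
  have hnn : ∀ P, 0 ≤ polyLimNorm h P 0 := fun P => iterLimNorm_nonneg hR _ _ _
  -- $(1+X)s_m=1-(-X)^m$ has norm at most twice that of 1, so large `s m` would do. If they are
  -- bounded, $s_m^2/m$ works: its image has norm $O(1/m)$, while its coefficient at $m-1$ is
  -- $\pm1$.
  let s : ℕ → ℝ[X] := fun m => ∑ i ∈ Finset.range m, (-X) ^ i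
  have hs : ∀ m, (1 + X) * s m = 1 - (-X) ^ m := fun m => by
    have := mul_neg_geom_sum (-X : ℝ[X]) m
    rwa [sub_neg_eq_add] at this
  have hdiff : ∀ (m : ℕ) (P : ℝ[X]), polyLimNorm h ((1 - (-X) ^ m) * P) 0 ≤
      2 * polyLimNorm h P 0 := fun m P => by
    have h1 := polyLimNorm_add_le hR P (-((-X) ^ m * P)) 0 (-0)
    rw [polyLimNorm_neg hR, polyLimNorm_neg_X_pow_mul hR, neg_zero, add_zero] at h1
    rw [sub_mul, one_mul, sub_eq_add_neg]
    linarith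
  by_cases hbdd : ∃ A, ∀ m, polyLimNorm h (s m) 0 ≤ A
  · obtain ⟨A, hA⟩ := hbdd
    obtain ⟨m, hm⟩ := exists_nat_gt (4 * A / δ)
    rw [div_lt_iff₀ hδ] at hm
    have hA0 : 0 ≤ A := (hnn _).trans (hA 0)
    have hm0 : (0 : ℝ) < m := by
      by_contra! hcon
      nlinarith
    refine ⟨(m : ℝ)⁻¹ • (s m * s m), ?_⟩
    have hcoeff : ∀ i, (s m).coeff i = if i < m then (-1) ^ i else 0 := fun i => by
      have h1 : s m = ∑ i ∈ Finset.range m, C ((-1 : ℝ) ^ i) * X ^ i := by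
        refine Finset.sum_congr rfl fun i _ => ?_
        rw [neg_pow, C_pow, C_neg, C_1]
      rw [h1]
      simp only [finsetSum_coeff, coeff_C_mul, coeff_X_pow, mul_ite, mul_one, mul_zero,
        Finset.sum_ite_eq, Finset.mem_range]
    have hc : |((m : ℝ)⁻¹ • (s m * s m)).coeff (m - 1)| = 1 := by
      have hm1 : 0 < m := by exact_mod_cast hm0
      rw [coeff_smul, smul_eq_mul, coeff_mul]
      have h1 : ∑ x ∈ Finset.HasAntidiagonal.antidiagonal (m - 1), (s m).coeff x.1 * (s m).coeff x.2 =
          ∑ x ∈ Finset.HasAntidiagonal.antidiagonal (m - 1), (-1 : ℝ) ^ (m - 1) := by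
        refine Finset.sum_congr rfl fun x hx => ?_
        rw [Finset.HasAntidiagonal.mem_antidiagonal] at hx
        rw [hcoeff, hcoeff, if_pos (by omega), if_pos (by omega), ← pow_add, hx]
      rw [h1, Finset.sum_const, Finset.Nat.card_antidiagonal, Nat.sub_add_cancel hm1, nsmul_eq_mul,
        inv_mul_cancel_left₀ hm0.ne', abs_pow, abs_neg, abs_one, one_pow]
    have hlow := abs_coeff_mul_le_polyLimNorm hR ((m : ℝ)⁻¹ • (s m * s m)) (m - 1)
    rw [hc, one_mul] at hlow
    have h1 := one_le_polyLimNorm_one_sub_X hR hsep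
    refine ⟨by linarith, ?_⟩
    rw [mul_smul_comm, ← mul_assoc, hs, ← smul_zero (m : ℝ)⁻¹, polyLimNorm_smul hR,
      abs_of_pos (inv_pos.2 hm0), inv_mul_le_iff₀ hm0, smul_zero]
    have h2 := hdiff m (s m)
    have h3 := hA m
    nlinarith
  · push Not at hbdd
    obtain ⟨m, hm⟩ := hbdd (2 * polyLimNorm h 1 0 / δ)
    refine ⟨s m, lt_of_le_of_lt (div_nonneg (mul_nonneg zero_le_two (hnn 1)) hδ.le) hm, ?_⟩
    rw [div_lt_iff₀ hδ] at hm
    have h1 := hdiff m 1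
    rw [hs]
    rw [mul_one] at h1
    linarith

/-- If $(1+X)P$ is negligible, then $P$ is nearly $-XP$, so $P-x$ and $P+x$ have nearly the same
norm by shift invariance. Their norms add up to at least twice that of $P$. -/
theorem exists_polyLimNorm_almost_orthogonal (hR : ∀ n, ‖h n‖ ≤ R)
    (hsep : Pairwise fun m n => 1 ≤ ‖h m - h n‖) {δ : ℝ} (hδ : 0 < δ) :
    ∃ P : ℝ[X], 0 < polyLimNorm h P 0 ∧
      ∀ x, (1 - δ) * polyLimNorm h P 0 ≤ polyLimNorm h P x := by
  obtain ⟨P, hP0, hP⟩ := exists_polyLimNorm_one_add_X_mul_le hR hsep hδ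
  refine ⟨P, hP0, fun x => ?_⟩
  have h1 := polyLimNorm_add_le hR P P x (-x)
  have h0 := polyLimNorm_smul hR 2 P (0 : E)
  rw [smul_zero, two_smul, abs_two] at h0
  rw [add_neg_cancel, h0] at h1
  have h2 := polyLimNorm_add_le hR ((1 + X) * P) (-(X * P)) 0 (-x)
  rw [polyLimNorm_neg hR, polyLimNorm_X_mul hR] at h2
  have h3 : (1 + X) * P + -(X * P) = P := by ring
  rw [h3, zero_add] at h2
  nlinarith

/-- Riesz's lemma in $F+G$ would not place the vector in $G$. Here the ultralimit estimate is
realised by vectors of $G$, simultaneously on a finite net of a ball of $F$. -/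
theorem exists_almost_orthogonal {X : Type*} [NormedAddCommGroup X] [NormedSpace ℝ X]
    {G F : Submodule ℝ X} (hG : ¬ FiniteDimensional ℝ G) [FiniteDimensional ℝ F] {δ : ℝ}
    (hδ : 0 < δ) : ∃ y ∈ G, ‖y‖ = 1 ∧ ∀ f ∈ F, 1 - δ ≤ ‖y + f‖ := by
  obtain ⟨R, h', -, hR', hsep'⟩ := exists_seq_norm_le_one_le_norm_sub (𝕜 := ℝ) hG
  let h : ℕ → X := fun n => h' n
  have hR : ∀ n, ‖h n‖ ≤ R := hR'
  have hsep : Pairwise fun m n => 1 ≤ ‖h m - h n‖ := hsep'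
  obtain ⟨r, hr0, hrδ, hr1⟩ : ∃ r > 0, 4 * r ≤ δ ∧ 4 * r ≤ 1 :=
    ⟨min (δ / 4) (1 / 4), by positivity, by linarith [min_le_left (δ / 4) (1 / 4)],
      by linarith [min_le_right (δ / 4) (1 / 4)]⟩
  obtain ⟨P, hP0, hP⟩ := exists_polyLimNorm_almost_orthogonal hR hsep hr0
  set A := polyLimNorm h P 0 with hA
  have hrA : 0 < r * A := mul_pos hr0 hP0
  have : ProperSpace F := FiniteDimensional.proper ℝ F
  -- Radius `3 * A` suffices: $\|y\|<(1+r)A$, so longer `f` are handled by the triangle inequality.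
  obtain ⟨t, -, ht, hcov⟩ := (isCompact_closedBall (0 : F) (3 * A)).finite_cover_balls hrA
  obtain ⟨y, hyG, hy⟩ := exists_approx_iterLimNorm hR (G := G) (fun n => (h' n).2)
    (ht.insert 0).toFinset (P.natDegree + 1) P.coeff (fun f : F => (f : X))
    (fun _ => (1 - 2 * r) * A) (fun f => polyLimNorm h P f + r * A) (fun f _ => by
      have h1 := hP f
      exact ⟨lt_of_lt_of_le (by nlinarith) h1, lt_add_of_pos_right _ hrA⟩)
  simp only [Finite.mem_toFinset, mem_insert_iff, forall_eq_or_imp, ZeroMemClass.coe_zero, zero_add,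
    ← hA] at hy
  obtain ⟨⟨hy1, hy2⟩, hy3⟩ := hy
  have hlow : ∀ f ∈ F, (1 - 3 * r) * A ≤ ‖y + f‖ := by
    intro f hf
    rcases le_or_gt ‖f‖ (3 * A) with hfA | hfA
    · obtain ⟨x, hx, hfx⟩ := mem_iUnion₂.1
        (hcov (show (⟨f, hf⟩ : F) ∈ _ by simpa using hfA))
      have h1 : ‖f - x‖ < r * A := by simpa [dist_eq_norm] using hfx
      have h2 := (hy3 x hx).1
      have h3 : (x : X) + y = (y + f) - (f - x) := by abel
      rw [h3] at h2
      have h4 := norm_sub_le (y + f) (f - x)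
      linarith
    · have h1 := norm_sub_le (y + f) y
      rw [add_sub_cancel_left] at h1
      nlinarith
  have hy0 : 0 < ‖y‖ := lt_of_le_of_lt (mul_nonneg (by linarith) hP0.le) hy1
  refine ⟨‖y‖⁻¹ • y, G.smul_mem _ hyG, ?_, fun f hf => ?_⟩
  · rw [norm_smul, norm_inv, norm_norm, inv_mul_cancel₀ hy0.ne']
  · have h1 : ‖y‖⁻¹ • y + f = ‖y‖⁻¹ • (y + ‖y‖ • f) := by
      rw [smul_add, inv_smul_smul₀ hy0.ne']
    rw [h1, norm_smul, norm_inv, norm_norm, ← div_eq_inv_mul, le_div_iff₀ hy0]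
    refine le_trans ?_ (hlow _ (F.smul_mem _ hf))
    nlinarith [mul_nonneg hr0.le hr0.le]

end IteratedLimit

/-! ### Norming functionals and existence of construction data. -/

theorem exists_dual_vanishing_of_one_le_norm_sub {E : Type*} [SeminormedAddCommGroup E]
    [NormedSpace ℝ E] {D : Submodule ℝ E} {x : E} (hx : ‖x‖ = 1) (hD : ∀ d ∈ D, 1 ≤ ‖x - d‖) :
    ∃ g : StrongDual ℝ E, (∀ z, |g z| ≤ ‖z‖) ∧ g x = 1 ∧ ∀ d ∈ D, g d = 0 := by
  have h1 : ‖(Submodule.Quotient.mk x : E ⧸ D)‖ = 1 := by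
    refine le_antisymm ((Submodule.Quotient.norm_mk_le D x).trans_eq hx)
      (le_of_forall_pos_le_add fun ε hε => ?_)
    obtain ⟨m, hm, hlt⟩ := Submodule.Quotient.norm_mk_lt (Submodule.Quotient.mk x : E ⧸ D) hε
    have h2 := hD (x - m) ((Submodule.Quotient.eq D).1 hm.symm)
    rw [sub_sub_cancel] at h2
    linarith
  obtain ⟨g, hg, hgx⟩ := exists_dual_vector ℝ (Submodule.Quotient.mk x : E ⧸ D) (by simp [h1])
  have hb : ∀ z, ‖(g.toLinearMap ∘ₗ D.mkQ) z‖ ≤ 1 * ‖z‖ := fun z => by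
    have h2 := g.le_opNorm (Submodule.Quotient.mk z)
    rw [hg] at h2
    exact h2.trans (by gcongr; exact Submodule.Quotient.norm_mk_le D z)
  refine ⟨(g.toLinearMap ∘ₗ D.mkQ).mkContinuous 1 hb, fun z => ?_, ?_, fun d hd => ?_⟩
  · simpa using hb z
  · simpa [h1] using hgx
  · have : (Submodule.Quotient.mk d : E ⧸ D) = 0 := (Submodule.Quotient.mk_eq_zero D).2 hd
    simp [this]

section ConstructionDataExistence

variable {X : Type*} [NormedAddCommGroup X] [NormedSpace ℝ X]

/-- In $X\oplus_1X$ the hypothesis says that $(e,0)$ has distance at least 1 from the space of all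
$(f,-\varepsilon f)$. A norming functional killing that space takes equal values at $(f,0)$ and
$(0,\varepsilon f)$, hence is small on $F$. -/
theorem exists_dual_norm_eq_one_abs_le {F : Submodule ℝ X} {e : X} {ε : ℝ} (hε : 0 < ε)
    (he : ‖e‖ = 1) (hF : ∀ f ∈ F, 1 ≤ ‖e - f‖ + ε * ‖f‖) :
    ∃ g : StrongDual ℝ X, ‖g‖ = 1 ∧ g e = 1 ∧ ∀ f ∈ F, |g f| ≤ ε * ‖f‖ := by
  let E := WithLp 1 (X × X)
  let ι : X →ₗ[ℝ] E := (WithLp.linearEquiv 1 ℝ (X × X)).symm.toLinearMap ∘ₗ LinearMap.inl ℝ X X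
  let κ : X →ₗ[ℝ] E := (WithLp.linearEquiv 1 ℝ (X × X)).symm.toLinearMap ∘ₗ LinearMap.inr ℝ X X
  have hnorm : ∀ a b, ‖ι a + κ b‖ = ‖a‖ + ‖b‖ := fun a b => by
    rw [WithLp.prod_norm_eq_of_L1]
    change ‖a + 0‖ + ‖0 + b‖ = _
    rw [add_zero, zero_add]
  have hι : ∀ a, ‖ι a‖ = ‖a‖ := fun a => by simpa using hnorm a 0
  have hκ : ∀ a, ‖κ a‖ = ‖a‖ := fun a => by simpa using hnorm 0 a
  obtain ⟨g, hg, hge, hgD⟩ := exists_dual_vanishing_of_one_le_norm_sub (D := F.map (ι - ε • κ))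
    (x := ι e) (by rw [hι, he]) (by
      rintro _ ⟨f, hf, rfl⟩
      have h1 : ι e - (ι - ε • κ) f = ι (e - f) + κ (ε • f) := by
        simp only [LinearMap.sub_apply, LinearMap.smul_apply, map_sub, map_smul]; abel
      rw [h1, hnorm, norm_smul, Real.norm_of_nonneg hε.le]
      exact hF f hf)
  have hb : ∀ z, ‖(g.toLinearMap ∘ₗ ι) z‖ ≤ 1 * ‖z‖ := fun z => by
    simpa [hι] using hg (ι z)
  refine ⟨(g.toLinearMap ∘ₗ ι).mkContinuous 1 hb, le_antisymm
    (LinearMap.mkContinuous_norm_le _ zero_le_one _) ?_, hge, fun f hf => ?_⟩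
  · have h1 := ((g.toLinearMap ∘ₗ ι).mkContinuous 1 hb).le_opNorm e
    rw [he, mul_one] at h1
    refine le_trans ?_ h1
    simp [hge]
  · have h1 := hgD _ (Submodule.mem_map_of_mem hf)
    rw [LinearMap.sub_apply, map_sub, LinearMap.smul_apply, map_smul, smul_eq_mul, sub_eq_zero]
      at h1
    change |g (ι f)| ≤ _
    rw [h1, abs_mul, abs_of_pos hε]
    gcongr
    exact (hg _).trans_eq (hκ f)

/-- An almost Birkhoff orthogonal vector can be perturbed to one having a norming functional that
is small on the subspace. -/
theorem exists_norming_pair {F : Submodule ℝ X} [FiniteDimensional ℝ F] {y : X} (hy : ‖y‖ = 1)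
    {δ ε : ℝ} (hδ1 : δ < 1) (hε : 0 < ε) (hF : ∀ f ∈ F, 1 - δ ≤ ‖y + f‖) :
    ∃ (e : X) (g : StrongDual ℝ X), ‖e‖ = 1 ∧ ‖g‖ = 1 ∧ g e = 1 ∧
      (∀ f ∈ F, |g f| ≤ ε * ‖f‖) ∧ ‖e - y‖ ≤ δ + δ / ε := by
  have : ProperSpace F := FiniteDimensional.proper ℝ F
  have hcont : Continuous fun f : F => ‖y + f‖ + ε * ‖f‖ := by fun_prop
  -- Minimise $\|y+f\|+\varepsilon\|f\|$ over $F$ and normalise $y+f_0$. Minimality is the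
  -- hypothesis of the previous lemma, and comparison with $f=0$ gives
  -- $\|f_0\|\le\delta/\varepsilon$.
  obtain ⟨f₀, hf₀⟩ := hcont.exists_forall_le' 0 (by
    filter_upwards [(tendsto_norm_cocompact_atTop (E := F)).eventually_ge_atTop (1 / ε)] with f hf
    rw [div_le_iff₀ hε] at hf
    simp only [ZeroMemClass.coe_zero, add_zero, norm_zero, mul_zero, hy]
    linarith [norm_nonneg (y + f)])
  have h0 := hf₀ 0
  simp only [ZeroMemClass.coe_zero, add_zero, norm_zero, mul_zero, hy] at h0
  have hlow := hF f₀ f₀.2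
  set d := ‖y + f₀‖ with hd
  have hd0 : 0 < d := by linarith
  have hnf : ‖f₀‖ ≤ δ / ε := by rw [le_div_iff₀ hε]; linarith
  have he : ‖d⁻¹ • (y + (f₀ : X))‖ = 1 := by
    rw [norm_smul, norm_inv, Real.norm_of_nonneg hd0.le, ← hd, inv_mul_cancel₀ hd0.ne']
  obtain ⟨g, hg, hge, hgF⟩ := exists_dual_norm_eq_one_abs_le hε he fun f hf => by
    have h1 := hf₀ (f₀ - d • ⟨f, hf⟩)
    have h2 : y + ((f₀ - d • ⟨f, hf⟩ : F) : X) = d • (d⁻¹ • (y + (f₀ : X)) - f) := by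
      rw [smul_sub, smul_inv_smul₀ hd0.ne']
      simp only [AddSubgroupClass.coe_sub, SetLike.val_smul]
      abel
    have h3 : ‖f₀ - d • (⟨f, hf⟩ : F)‖ ≤ ‖f₀‖ + d * ‖f‖ := by
      refine (norm_sub_le _ _).trans ?_
      rw [norm_smul, Real.norm_of_nonneg hd0.le]
      rfl
    rw [h2, norm_smul, Real.norm_of_nonneg hd0.le] at h1
    refine le_of_mul_le_mul_left (a := d) ?_ hd0
    nlinarith
  refine ⟨_, g, he, hg, hge, hgF, ?_⟩
  have h1 : d⁻¹ • (y + (f₀ : X)) - y = (1 - d) • (d⁻¹ • (y + (f₀ : X))) + f₀ := by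
    rw [sub_smul, smul_inv_smul₀ hd0.ne']
    module
  have hd1 : d ≤ 1 := by nlinarith [norm_nonneg f₀]
  rw [h1]
  refine (norm_add_le _ _).trans ?_
  rw [norm_smul, he, Real.norm_of_nonneg (by linarith)]
  have : ‖(f₀ : X)‖ ≤ δ / ε := hnf
  linarith

theorem not_finiteDimensional_ker_pi {ι : Type*} [Finite ι] (hdim : ¬ FiniteDimensional ℝ X)
    (φ : ι → X →ₗ[ℝ] ℝ) : ¬ FiniteDimensional ℝ (LinearMap.ker (LinearMap.pi φ)) := by
  intro hfin
  have : Module.Finite ℝ (X ⧸ LinearMap.ker (LinearMap.pi φ)) :=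
    Module.Finite.equiv (LinearMap.pi φ).quotKerEquivRange.symm
  exact hdim (Module.Finite.of_submodule_quotient (LinearMap.ker (LinearMap.pi φ)))

/-- An infinite-dimensional separable space contains an almost biorthogonal sequence of norming
pairs whose functionals are weak* null. -/
theorem exists_almost_biorthogonal_seq [TopologicalSpace.SeparableSpace X]
    (hdim : ¬ FiniteDimensional ℝ X) {ε : ℝ} (hε : 0 < ε) :
    ∃ (e : ℕ → X) (g : ℕ → StrongDual ℝ X), (∀ n, ‖e n‖ = 1) ∧ (∀ n, ‖g n‖ = 1) ∧
      (∀ n, g n (e n) = 1) ∧ (∀ n m, n ≠ m → |g n (e m)| < ε) ∧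
      ∀ x, Tendsto (fun n => g n x) atTop (𝓝 0) := by
  obtain ⟨d, hd⟩ := TopologicalSpace.exists_dense_seq X
  -- The third entry counts the dense vectors on which the functional is already small; it increases
  -- along the sequence, which yields weak* nullity.
  let P : X × StrongDual ℝ X × ℕ → Prop := fun a => ‖a.1‖ = 1 ∧ ‖a.2.1‖ = 1 ∧ a.2.1 a.1 = 1 ∧
    ∀ i < a.2.2, |a.2.1 (d i)| ≤ 1 / (a.2.2 + 1) * ‖d i‖
  let r : X × StrongDual ℝ X × ℕ → X × StrongDual ℝ X × ℕ → Prop := fun a b =>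
    |a.2.1 b.1| < ε ∧ |b.2.1 a.1| < ε ∧ a.2.2 < b.2.2
  obtain ⟨f, hfP, hfr⟩ := exists_seq_of_forall_finset_exists P r fun s hs => by
    obtain ⟨k, hk⟩ : ∃ k : ℕ, ∀ a ∈ s, a.2.2 < k :=
      ⟨s.sup (fun a => a.2.2) + 1, fun a ha =>
        Nat.lt_succ_of_le (Finset.le_sup (f := fun a : X × StrongDual ℝ X × ℕ => a.2.2) ha)⟩
    let F : Submodule ℝ X :=
      Submodule.span ℝ (d '' Iio k ∪ Prod.fst '' (s : Set (X × StrongDual ℝ X × ℕ)))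
    have : FiniteDimensional ℝ F := FiniteDimensional.span_of_finite ℝ
      (((finite_Iio k).image d).union (s.finite_toSet.image _))
    have hG := not_finiteDimensional_ker_pi hdim fun a : s => a.1.2.1.toLinearMap
    obtain ⟨η, hη0, hηε, hηk⟩ : ∃ η > 0, 2 * η ≤ ε ∧ η ≤ 1 / ((k : ℝ) + 1) :=
      ⟨min (ε / 2) (1 / ((k : ℝ) + 1)), by positivity,
        by linarith [min_le_left (ε / 2) (1 / ((k : ℝ) + 1))], min_le_right _ _⟩
    -- Makes $\delta+\delta/\eta\le\frac23\varepsilon$. As `y` lies in the kernels of the earlier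
    -- functionals, this bounds their values at `e`.
    obtain ⟨δ, hδ0, hδ1, hδε, hδη⟩ : ∃ δ > 0, 2 * δ ≤ 1 ∧ 3 * δ ≤ ε ∧ 3 * δ ≤ ε * η :=
      ⟨min (min (1 / 2) (ε / 3)) (ε * η / 3), by positivity,
        by linarith [min_le_left (min (1 / 2) (ε / 3)) (ε * η / 3), min_le_left (1 / 2) (ε / 3)],
        by linarith [min_le_left (min (1 / 2) (ε / 3)) (ε * η / 3), min_le_right (1 / 2) (ε / 3)],
        by linarith [min_le_right (min (1 / 2) (ε / 3)) (ε * η / 3)]⟩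
    obtain ⟨y, hyG, hy1, hyF⟩ := exists_almost_orthogonal (F := F) hG hδ0
    obtain ⟨e, g, he, hg, hge, hgF, hey⟩ := exists_norming_pair hy1 (by linarith) hη0 hyF
    refine ⟨(e, g, k), ⟨he, hg, hge, fun i hi => ?_⟩, fun a ha => ⟨?_, ?_, hk a ha⟩⟩
    · refine (hgF _ (Submodule.subset_span (Or.inl (mem_image_of_mem d hi)))).trans ?_
      gcongr
    · have h1 : a.2.1 y = 0 := congr_fun (LinearMap.mem_ker.1 hyG) ⟨a, ha⟩
      have h2 : |a.2.1 (e - y)| ≤ ‖e - y‖ := by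
        simpa [(hs a ha).2.1] using a.2.1.le_opNorm (e - y)
      rw [map_sub, h1, sub_zero] at h2
      have h3 : δ / η ≤ ε / 3 := by rw [div_le_iff₀ hη0]; linarith
      change |a.2.1 e| < ε
      linarith
    · have h1 := hgF a.1 (Submodule.subset_span (Or.inr (mem_image_of_mem Prod.fst ha)))
      rw [(hs a ha).1] at h1
      change |g a.1| < ε
      linarith
  have hmono : StrictMono fun n => (f n).2.2 := strictMono_nat_of_lt_succ fun n =>
    (hfr n (n + 1) n.lt_succ_self).2.2
  refine ⟨fun n => (f n).1, fun n => (f n).2.1, fun n => (hfP n).1, fun n => (hfP n).2.1,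
    fun n => (hfP n).2.2.1, fun n m hnm => ?_, fun x => ?_⟩
  · rcases lt_or_gt_of_ne hnm with h | h
    · exact (hfr n m h).1
    · exact (hfr m n h).2.1
  · rw [Metric.tendsto_atTop']
    intro η hη
    obtain ⟨_, hxd, i, rfl⟩ := Metric.dense_iff.1 hd x (η / 2) (half_pos hη)
    rw [mem_ball_iff_norm, norm_sub_rev] at hxd
    have hlim : Tendsto (fun k : ℕ => 1 / ((k : ℝ) + 1) * ‖d i‖) atTop (𝓝 0) := by
      simpa using tendsto_one_div_add_atTop_nhds_zero_nat.mul_const ‖d i‖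
    obtain ⟨k₀, hk₀⟩ := eventually_atTop.1 (hlim.eventually (gt_mem_nhds (half_pos hη)))
    refine ⟨max i k₀, fun n hn => ?_⟩
    have hn' : n ≤ (f n).2.2 := hmono.id_le n
    have h1 := (hfP n).2.2.2 i (by omega)
    have h2 := hk₀ (f n).2.2 (by omega)
    have h3 : |(f n).2.1 (x - d i)| ≤ ‖x - d i‖ := by
      simpa [(hfP n).2.1] using (f n).2.1.le_opNorm (x - d i)
    have h4 : (f n).2.1 x = (f n).2.1 (x - d i) + (f n).2.1 (d i) := by rw [map_sub]; ring
    rw [dist_zero_right, Real.norm_eq_abs, h4]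
    refine (abs_add_le _ _).trans_lt ?_
    linarith

theorem nonempty_constructionData [TopologicalSpace.SeparableSpace X]
    (hdim : ¬ FiniteDimensional ℝ X) {ρ : ℝ} (hρ0 : 0 < ρ) (hρ1 : ρ < 1 / 4) :
    Nonempty (ConstructionData X ρ) := by
  obtain ⟨e, g, he, hg, hge, hbi, hnull⟩ :=
    exists_almost_biorthogonal_seq hdim (show 0 < ρ / 800 by positivity)
  have : Nonempty (Metric.sphere (0 : X) 1) := ⟨⟨e 0, by simp [he]⟩⟩
  obtain ⟨s, hs⟩ := TopologicalSpace.exists_dense_seq (Metric.sphere (0 : X) 1)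
  have hs1 : ∀ j, ‖(s j : X)‖ = 1 := fun j => by simp
  choose φ hφ1 hφs using fun j => exists_dual_vector ℝ (s j : X) (by rw [hs1]; exact one_ne_zero)
  have hc : 1 < (1 - ρ / 8)⁻¹ := (one_lt_inv₀ (by linarith)).2 (by linarith)
  let τ : ℕ → ℝ := fun i => ρ / (32 * ((i : ℝ) + 1))
  have hτ0 : ∀ i, 0 < τ i := fun i => by positivity
  let ε : ℕ → ℝ := fun i => min (τ i * ρ / 12800) ((1 - ρ / 8)⁻¹ - 1) / 2
  have hpos : ∀ i, 0 < min (τ i * ρ / 12800) ((1 - ρ / 8)⁻¹ - 1) := fun i =>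
    lt_min (by have := hτ0 i; positivity) (by linarith)
  exact ⟨{
    -- In $n=\mathrm{pair}(i,j)$, `i` is the block and fixes `t` and `η`, while `j` runs through the
    -- dense directions.
    A := fun i => {n | n.unpair.1 = i}
    A_infinite := fun i => infinite_of_injective_forall_mem (f := fun j => Nat.pair i j)
      (fun a b hab => (Nat.pair_eq_pair.1 hab).2) (fun j => by simp)
    A_disjoint := fun i j hij => disjoint_left.2 fun n hi hj => hij (hi.symm.trans hj)
    A_cover := eq_univ_of_forall fun n => mem_iUnion.2 ⟨_, rfl⟩
    v := fun n => s n.unpair.2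
    vStar := fun n => φ n.unpair.2
    e := e
    eStar := g
    t := fun n => τ n.unpair.1
    η := fun n => ε n.unpair.1
    ε := ε
    t_pos := fun n => hτ0 _
    t_lt := fun n => by
      refine div_lt_div_of_pos_left hρ0 (by norm_num) ?_
      have : (0 : ℝ) ≤ (n.unpair.1 : ℝ) := Nat.cast_nonneg _
      linarith
    t_small := fun r hr => by
      obtain ⟨i, hi⟩ := exists_nat_gt (ρ / r)
      refine ⟨i, ?_⟩
      rintro n rfl
      rw [div_lt_iff₀ hr] at hi
      rw [div_lt_iff₀ (by positivity)]
      have : (0 : ℝ) ≤ (n.unpair.1 : ℝ) := Nat.cast_nonneg _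
      nlinarith
    norm_v := fun n => hs1 _
    norm_vStar := fun n => hφ1 _
    vStar_v := fun n => (hφs n.unpair.2).trans (by simp [hs1])
    v_dense := fun i x hx => by
      have h1 : (⟨x, hx⟩ : Metric.sphere (0 : X) 1) ∈ closure (range s) := hs _
      have h2 := image_closure_subset_closure_image continuous_subtype_val
        (mem_image_of_mem Subtype.val h1)
      refine closure_mono ?_ h2
      rintro _ ⟨_, ⟨j, rfl⟩, rfl⟩
      exact ⟨Nat.pair i j, by simp, by simp⟩
    norm_e := he
    norm_eStar := hg
    eStar_e := hge
    almost_biorthogonal := hbi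
    weakStar_null := hnull
    η_pos := fun n => half_pos (hpos _)
    η_lt := fun n => half_lt_self (hpos _)
    η_eq := by
      rintro i n rfl
      rfl }⟩

end ConstructionDataExistence

/-! ### Assembly of the main theorem. -/

theorem mainTheorem2 {X : Type*} [NormedAddCommGroup X] [NormedSpace ℝ X] [CompleteSpace X]
    [TopologicalSpace.SeparableSpace X] (hdim : ¬ FiniteDimensional ℝ X)
    (hLUR : LocallyUniformlyConvex X) (ρ : ℝ) (hρ0 : 0 < ρ) (hρ1 : ρ < 1 / 4) :
    Nonempty (ConstructionData X ρ) ∧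
    ∀ D : ConstructionData X ρ,
      (∃ N : ℕ → Seminorm ℝ X, D.IsLURApproximation N) ∧
      ∀ N : ℕ → Seminorm ℝ X, D.IsLURApproximation N →
        ∃ p : Seminorm ℝ X, IsFinalNorm ρ N p ∧
          LocallyUniformlyConvex (Renormed p) ∧
          (∀ x, (1 - ρ / 8)⁻¹ * ‖x‖ ≤ p x ∧
            p x ≤ (1 - ρ / 8)⁻¹ * (1 - ρ)⁻¹ * ‖x‖) ∧
          (∃ T : X ≃L[ℝ] Renormed p,
            ‖(T : X →L[ℝ] Renormed p)‖ * ‖(T.symm : Renormed p →L[ℝ] X)‖ ≤ (1 - ρ)⁻¹) ∧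
          ∀ K : Set (Renormed p), IsCompact K → Convex ℝ K → K.Nontrivial →
            (∃! R : Renormed p → K, IsNearestPointMap K R) ∧
            ∀ R : Renormed p → K, IsNearestPointMap K R →
              Continuous R ∧ ¬ UniformContinuous R := by
  refine ⟨nonempty_constructionData hdim hρ0 hρ1, fun D =>
    ⟨D.exists_isLURApproximation hρ0 hρ1 hLUR, fun N h => ?_⟩⟩
  obtain ⟨p, hp⟩ := h.exists_isFinalNorm hρ0 hρ1
  obtain ⟨T, hT, hTnorm⟩ := hp.exists_continuousLinearEquiv h hρ0 hρ1
  have hpLUR := hp.locallyUniformlyConvex h hρ0 hρ1 hLUR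
  refine ⟨p, hp, hpLUR, fun x => ⟨hp.mul_norm_le x, hp.le_mul_norm h hρ0 hρ1 x⟩, ⟨T, hTnorm⟩,
    fun K hK hconv hnt => ⟨hpLUR.existsUnique_isNearestPointMap (fun x hx => ?_) hK hconv
      hnt.nonempty, fun R hR => ⟨hpLUR.continuous_of_isNearestPointMap hconv hR, fun hunif => ?_⟩⟩⟩
  · have h1 := hp.norm_le hρ0 hρ1 ((toRenormed p).symm x)
    have h2 : p ((toRenormed p).symm x) = 0 := hx
    rw [h2, norm_le_zero_iff] at h1
    exact (LinearEquiv.map_eq_zero_iff _).1 h1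
  · have hTs : ∀ x, T.symm x = (toRenormed p).symm x := fun x => by
      rw [T.symm_apply_eq, hT, LinearEquiv.apply_symm_apply]
    -- `K` is moved back to the original norm, where compactness meets the weak* null functionals.
    obtain ⟨c, hc, H⟩ := hp.exists_close_with_far_nearest h hdim hρ0 hρ1
      (hK.image T.symm.continuous) (hnt.image T.symm.injective)
    obtain ⟨δ, hδ, hR'⟩ := Metric.uniformContinuous_iff.1 hunif c hc
    obtain ⟨x, x', hxx', hfar⟩ := H δ hδ
    have hdist : ∀ a b : X, dist (T a) (T b) = p (a - b) := fun a b => by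
      rw [dist_eq_norm, ← map_sub, hT, norm_toRenormed]
    have hmin : ∀ a : X, ∀ w ∈ T.symm '' K, p (a - T.symm (R (T a))) ≤ p (a - w) := by
      rintro a _ ⟨w, hw, rfl⟩
      rw [← hdist, ← hdist, T.apply_symm_apply, T.apply_symm_apply, dist_eq_norm, dist_eq_norm]
      exact hR.norm_sub_le hw
    have h1 := hfar _ (mem_image_of_mem _ (R (T x)).2) _ (mem_image_of_mem _ (R (T x')).2)
      (hmin x) (hmin x')
    rw [← hdist, T.apply_symm_apply, T.apply_symm_apply] at h1
    have h2 := hR' (by rw [hdist]; exact hxx' : dist (T x) (T x') < δ)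
    rw [Subtype.dist_eq] at h2
    linarith
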